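/- For complex numbers $\mu_0,\dots,\mu_m$ let $E_{(\mu_0,\dots,\mu_m)}$ be the space of all $f\in C^\infty(\mathbb R,\mathbb C)$ with $\left(\frac{d}{dx}-\mu_0\right)\cdots\left(\frac{d}{dx}-\mu_m\right)f=0$. Its Bernstein basis for $a<b$ is the (unique, if it exists) system $p_{(\mu_0,\dots,\mu_m),k}\in E_{(\mu_0,\dots,\mu_m)}$, $k=0,\dots,m$, such that $p_{(\mu_0,\dots,\mu_m),k}$ has a zero of order exactly $k$ at $a$, a zero of order exactly $m-k$ at $b$, and $k$-th derivative equal to $1$ at $a$. Let $a<b$, let $\lambda_0,\lambda_1,\lambda_2$ be distinct real numbers, and for each $n\ge 2$ let $\Lambda_n=(\lambda_0,\lambda_1,\lambda_2,\lambda_3,\dots,\lambda_n)$, where the complex numbers $\lambda_j=\lambda_j^{(n)}$, $3\le j\le n$, may vary with $n$. Suppose that for every $n\ge2$ the space $E_{\Lambda_n}$ is closed under complex conjugation, that there is $M>0$ with $|\operatorname{Im}\lambda_j|\le M$ for all $n\ge 2$ and $0\le j\le n$, and that $b-a<\pi/M_n$ for all $n\ge2$, where $M_n=\max_{0\le j\le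 n}|\operatorname{Im}\lambda_j|$ (no condition if $M_n=0$). (Then all Bernstein bases below exist, and all ratios of them below have positive limits.) For each $n\ge 2$ define $t_0=a$ and $t_1,\dots,t_n$ inductively by $$e^{(\lambda_0-\lambda_1)(t_k-t_{k-1})}=\lim_{x\uparrow b}\frac{p_{(\lambda_0,\lambda_2,\dots,\lambda_n),k-1}(x)}{p_{(\lambda_1,\lambda_2,\dots,\lambda_n),k-1}(x)},$$ put $$\alpha_k=e^{-\lambda_0(t_k-a)}(-1)^k\prod_{l=0}^{k-1}\lim_{x\uparrow b}\frac{\frac{d}{dx}p_{\Lambda_n,l}(x)}{p_{(\lambda_1,\dots,\lambda_n),l}(x)}\quad(0\le k\le n),$$ and let $B_{\Lambda_n}f=\sum_{k=0}^n\alpha_k f(t_k)\,p_{\Lambda_n,k}$ be the Bernstein operator on $C([a,b],\mathbb C)$. For $0\le k\le n-1$ put $$b(n,k)=\lim_{x\uparrow b}\frac{p_{(\lambda_0,\lambda_1,\lambda_3,\dots,\lambda_n),k}(x)}{p_{(\lambda_1,\lambda_2,\dots,\lambda_n),k}(x)}.$$ Assume that, as $n\to\infty$, $t_{k}-t_{k-1}\to0$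 uniformly in $k=1,\dots,n$, and $$\frac{\log b(n,k)}{t_k-t_{k+1}}\to\lambda_2-\lambda_0\quad\text{uniformly in }k=0,\dots,n-1.$$ Then for every $f\in C([a,b],\mathbb C)$ the functions $B_{\Lambda_n}f$ converge to $f$ uniformly on $[a,b]$. -/

import Mathlib

open Filter Topology
open scoped ContDiff

noncomputable section

/-- For `Λ = (λ₀, …, λₙ)`, the operator `(d/dx - λ₀) ⋯ (d/dx - λₙ)`. -/
def diffOp : List ℂ → (ℝ → ℂ) → ℝ → ℂ
  | [], f => f
  | μ :: Λ, f => fun x => deriv (diffOp Λ f) x - μ * diffOp Λ f x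

/-- The space `E_Λ` of exponential polynomials: smooth solutions of `L f = 0`. -/
def expPolySpace (Λ : List ℂ) : Set (ℝ → ℂ) :=
  {f | ContDiff ℝ ∞ f ∧ ∀ x, diffOp Λ f x = 0}

/-- The set of functions `E` is closed under complex conjugation. -/
def ClosedUnderConj (E : Set (ℝ → ℂ)) : Prop :=
  ∀ f ∈ E, (fun x => starRingEnd ℂ (f x)) ∈ E

/-- `f` has a zero of order (exactly) `k` at `c`. -/
def HasZeroOfOrder (f : ℝ → ℂ) (k : ℕ) (c : ℝ) : Prop :=
  (∀ i < k, iteratedDeriv i f c = 0) ∧ iteratedDeriv k f c ≠ 0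

/-- `p 0, …, p n` is the (normalized) Bernstein basis of `E_Λ` for `a, b`, where `Λ` has
`n + 1` entries; the values `p k` with `k > n` play no role. -/
def IsBernsteinBasis (Λ : List ℂ) (a b : ℝ) (p : ℕ → ℝ → ℂ) : Prop :=
  ∀ k < Λ.length, p k ∈ expPolySpace Λ ∧ HasZeroOfOrder (p k) k a ∧
    HasZeroOfOrder (p k) (Λ.length - 1 - k) b ∧ iteratedDeriv k (p k) a = 1

/-- The Bernstein basis `p_{Λ,k}`, `k = 0, …, n`, of `E_Λ` for `a, b`. It is unique when it
exists; if there is none the value is arbitrary. -/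
def bernsteinBasis (Λ : List ℂ) (a b : ℝ) : ℕ → ℝ → ℂ :=
  Classical.epsilon (IsBernsteinBasis Λ a b)

/-- The limit of `f x / g x` as `x` tends to `b` from inside the interval. -/
def boundaryLimit (f g : ℝ → ℂ) (b : ℝ) : ℂ :=
  limUnder (𝓝[<] b) (fun x => f x / g x)

/-- The nodes `t_k` of the Bernstein operator for `(λ₀, λ₁, R)` with `R = (λ₂, …, λₙ)`:
`t₀ = a` and `exp ((λ₀ - λ₁) (t_{k+1} - t_k)) = lim_{x → b} p_{(λ₀,R),k} x / p_{(λ₁,R),k} x`.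
(The limit is a positive real number for `k < n`.) -/
def bernsteinNode (a b lam0 lam1 : ℝ) (R : List ℂ) : ℕ → ℝ
  | 0 => a
  | k + 1 => bernsteinNode a b lam0 lam1 R k +
      Real.log (boundaryLimit (bernsteinBasis ((lam0 : ℂ) :: R) a b k)
        (bernsteinBasis ((lam1 : ℂ) :: R) a b k) b).re / (lam0 - lam1)

/-- The coefficients `α_k` of the Bernstein operator for `(λ₀, λ₁, R)`. -/
def bernsteinCoeff (a b lam0 lam1 : ℝ) (R : List ℂ) (k : ℕ) : ℂ :=
  (Real.exp (-lam0 * (bernsteinNode a b lam0 lam1 R k - a)) : ℂ) * (-1) ^ k *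
    ∏ l ∈ Finset.range k,
      boundaryLimit (deriv (bernsteinBasis ((lam0 : ℂ) :: (lam1 : ℂ) :: R) a b l))
        (bernsteinBasis ((lam1 : ℂ) :: R) a b l) b

/-- The Bernstein operator `B_Λ f = ∑_{k=0}^n α_k f(t_k) p_{Λ,k}` for `Λ = (λ₀, λ₁, R)`, a
vector with `n + 1` entries. Only the values of `f` at the nodes enter. -/
def bernsteinOp (a b lam0 lam1 : ℝ) (R : List ℂ) (f : ℝ → ℂ) (x : ℝ) : ℂ :=
  ∑ k ∈ Finset.range (R.length + 2),
    bernsteinCoeff a b lam0 lam1 R k * f (bernsteinNode a b lam0 lam1 R k) *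
      bernsteinBasis ((lam0 : ℂ) :: (lam1 : ℂ) :: R) a b k x

/-- `b(n,k) = lim_{x → b} p_{(λ₀,λ₁,T),k} x / p_{(λ₁,λ₂,T),k} x` with `T = (λ₃, …, λₙ)`.
(The limit is a positive real number for `k < n`.) -/
def ratioB (a b lam0 lam1 lam2 : ℝ) (T : List ℂ) (k : ℕ) : ℝ :=
  (boundaryLimit (bernsteinBasis ((lam0 : ℂ) :: (lam1 : ℂ) :: T) a b k)
    (bernsteinBasis ((lam1 : ℂ) :: (lam2 : ℂ) :: T) a b k) b).re

end

/-!
Removing conjugate pairs two at a time, Rolle arguments with Wronskians show that `E_Λ` is a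
Chebyshev space on `[a, b]`. Hence the Bernstein basis functions are positive inside the interval,
and differentiating them shows that the real exponentials of `E_Λ` have positive coefficients in
the Bernstein basis. The Bernstein operator thus has the form `f ↦ ∑ W_k f(t_k)` with nonnegative
weights `W_k`; the choice of nodes and coefficients makes it reproduce `exp (λ₀ x)` and
`exp (λ₁ x)`, and the asymptotics of `log b(n,k)` make it reproduce `exp (λ₂ x)` in the limit. A
Korovkin argument for these three exponentials concludes.
-/

/-! ### The operators `d/dx - μ` and exponential polynomials -/

section ExpPoly

variable {μ ν : ℂ} {Λ Λ' : List ℂ} {f g : ℝ → ℂ}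

/-- The operator `d/dx - μ`. -/
noncomputable def firstOrder (μ : ℂ) (f : ℝ → ℂ) : ℝ → ℂ := deriv f - μ • f

lemma firstOrder_apply (μ : ℂ) (f : ℝ → ℂ) (x : ℝ) : firstOrder μ f x = deriv f x - μ * f x := rfl

lemma diffOp_cons (μ : ℂ) (Λ : List ℂ) (f : ℝ → ℂ) :
    diffOp (μ :: Λ) f = firstOrder μ (diffOp Λ f) := rfl

lemma contDiff_deriv (hf : ContDiff ℝ ∞ f) : ContDiff ℝ ∞ (deriv f) :=
  (contDiff_infty_iff_deriv.1 hf).2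

lemma hasDerivAt_of_contDiff (hf : ContDiff ℝ ∞ f) (x : ℝ) : HasDerivAt f (deriv f x) x :=
  ((contDiff_infty_iff_deriv.1 hf).1 x).hasDerivAt

lemma contDiff_firstOrder (μ : ℂ) (hf : ContDiff ℝ ∞ f) : ContDiff ℝ ∞ (firstOrder μ f) :=
  (contDiff_deriv hf).sub (hf.const_smul μ)

lemma contDiff_diffOp (Λ : List ℂ) (hf : ContDiff ℝ ∞ f) : ContDiff ℝ ∞ (diffOp Λ f) := by
  induction Λ with
  | nil => exact hf
  | cons μ Λ ih => exact contDiff_firstOrder μ ih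

lemma deriv_firstOrder (μ : ℂ) (hf : ContDiff ℝ ∞ f) :
    deriv (firstOrder μ f) = firstOrder μ (deriv f) :=
  funext fun x => ((hasDerivAt_of_contDiff (contDiff_deriv hf) x).sub
    ((hasDerivAt_of_contDiff hf x).const_smul μ)).deriv

lemma firstOrder_comm (μ ν : ℂ) (hf : ContDiff ℝ ∞ f) :
    firstOrder μ (firstOrder ν f) = firstOrder ν (firstOrder μ f) := by
  funext x
  simp only [firstOrder_apply, deriv_firstOrder _ hf]
  ring

lemma firstOrder_zero (μ : ℂ) : firstOrder μ 0 = 0 := by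
  funext x
  simp [firstOrder_apply]

lemma firstOrder_add (μ : ℂ) (hf : ContDiff ℝ ∞ f) (hg : ContDiff ℝ ∞ g) :
    firstOrder μ (f + g) = firstOrder μ f + firstOrder μ g := by
  funext x
  simp only [Pi.add_apply, firstOrder_apply,
    ((hasDerivAt_of_contDiff hf x).add (hasDerivAt_of_contDiff hg x)).deriv]
  ring

lemma firstOrder_smul (μ c : ℂ) (f : ℝ → ℂ) : firstOrder μ (c • f) = c • firstOrder μ f := by
  funext x
  simp only [Pi.smul_apply, smul_eq_mul, firstOrder_apply, deriv_const_smul_field]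
  ring

lemma firstOrder_sum_smul {ι : Type*} (μ : ℂ) {s : Finset ι} (c : ι → ℂ) (f : ι → ℝ → ℂ)
    (hf : ∀ i ∈ s, ContDiff ℝ ∞ (f i)) :
    firstOrder μ (∑ i ∈ s, c i • f i) = ∑ i ∈ s, c i • firstOrder μ (f i) := by
  funext x
  have hd : HasDerivAt (∑ i ∈ s, c i • f i) (∑ i ∈ s, c i • deriv (f i) x) x :=
    HasDerivAt.sum fun i hi => (hasDerivAt_of_contDiff (hf i hi) x).const_smul (c i)
  simp only [firstOrder_apply, hd.deriv, Finset.sum_apply, Pi.smul_apply, smul_eq_mul, mul_sub,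
    Finset.mul_sum, Finset.sum_sub_distrib, mul_left_comm]

lemma diffOp_firstOrder (μ : ℂ) (Λ : List ℂ) (hf : ContDiff ℝ ∞ f) :
    diffOp Λ (firstOrder μ f) = firstOrder μ (diffOp Λ f) := by
  induction Λ with
  | nil => rfl
  | cons ν Λ ih => rw [diffOp_cons, diffOp_cons, ih, firstOrder_comm _ _ (contDiff_diffOp Λ hf)]

lemma diffOp_perm (h : Λ.Perm Λ') (hf : ContDiff ℝ ∞ f) : diffOp Λ f = diffOp Λ' f := by
  induction h with
  | nil => rfl
  | cons μ _ ih => rw [diffOp_cons, diffOp_cons, ih]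
  | swap μ ν Λ => exact firstOrder_comm _ _ (contDiff_diffOp Λ hf)
  | trans _ _ ih₁ ih₂ => exact ih₁.trans ih₂

lemma diffOp_add (Λ : List ℂ) (hf : ContDiff ℝ ∞ f) (hg : ContDiff ℝ ∞ g) :
    diffOp Λ (f + g) = diffOp Λ f + diffOp Λ g := by
  induction Λ with
  | nil => rfl
  | cons μ Λ ih =>
    rw [diffOp_cons, ih, firstOrder_add μ (contDiff_diffOp Λ hf) (contDiff_diffOp Λ hg)]
    rfl

lemma diffOp_smul (Λ : List ℂ) (c : ℂ) (f : ℝ → ℂ) : diffOp Λ (c • f) = c • diffOp Λ f := by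
  induction Λ with
  | nil => rfl
  | cons μ Λ ih => rw [diffOp_cons, ih, firstOrder_smul, ← diffOp_cons]

lemma mem_expPolySpace : f ∈ expPolySpace Λ ↔ ContDiff ℝ ∞ f ∧ diffOp Λ f = 0 :=
  and_congr_right fun _ => funext_iff.symm

lemma expPolySpace_perm (h : Λ.Perm Λ') : expPolySpace Λ = expPolySpace Λ' := by
  ext f
  exact and_congr_right fun hf => by rw [diffOp_perm h hf]

lemma mem_expPolySpace_cons :
    f ∈ expPolySpace (μ :: Λ) ↔ ContDiff ℝ ∞ f ∧ firstOrder μ f ∈ expPolySpace Λ := by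
  simp only [mem_expPolySpace, diffOp_cons]
  constructor
  · rintro ⟨hf, h⟩
    exact ⟨hf, contDiff_firstOrder μ hf, (diffOp_firstOrder μ Λ hf).trans h⟩
  · rintro ⟨hf, -, h⟩
    exact ⟨hf, (diffOp_firstOrder μ Λ hf).symm.trans h⟩

/-- The space `E_Λ` as a complex vector space. -/
def expPolySubmodule (Λ : List ℂ) : Submodule ℂ (ℝ → ℂ) where
  carrier := expPolySpace Λ
  zero_mem' := mem_expPolySpace.2
    ⟨contDiff_const, by simpa using diffOp_smul Λ 0 (0 : ℝ → ℂ)⟩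
  add_mem' hf hg := mem_expPolySpace.2 ⟨hf.1.add hg.1, by
    rw [diffOp_add Λ hf.1 hg.1, (mem_expPolySpace.1 hf).2, (mem_expPolySpace.1 hg).2, add_zero]⟩
  smul_mem' c _ hf := mem_expPolySpace.2 ⟨hf.1.const_smul c, by
    rw [diffOp_smul, (mem_expPolySpace.1 hf).2, smul_zero]⟩

lemma mem_expPolySpace_cons_of_mem (μ : ℂ) (hf : f ∈ expPolySpace Λ) :
    f ∈ expPolySpace (μ :: Λ) :=
  mem_expPolySpace.2 ⟨hf.1, by rw [diffOp_cons, (mem_expPolySpace.1 hf).2, firstOrder_zero]⟩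

lemma contDiff_star (hf : ContDiff ℝ ∞ f) : ContDiff ℝ ∞ (star f) :=
  (starL' ℝ : ℂ ≃L[ℝ] ℂ).contDiff.comp hf

lemma deriv_star (f : ℝ → ℂ) : deriv (star f) = star (deriv f) := deriv.star'

lemma firstOrder_star (μ : ℂ) (f : ℝ → ℂ) :
    firstOrder (star μ) (star f) = star (firstOrder μ f) := by
  simp only [firstOrder, deriv_star, star_sub, star_smul]

lemma diffOp_star (Λ : List ℂ) (f : ℝ → ℂ) :
    diffOp (Λ.map star) (star f) = star (diffOp Λ f) := by
  induction Λ with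
  | nil => rfl
  | cons μ Λ ih => rw [List.map_cons, diffOp_cons, ih, firstOrder_star, ← diffOp_cons]

lemma star_mem_expPolySpace (hf : f ∈ expPolySpace Λ) : star f ∈ expPolySpace (Λ.map star) :=
  mem_expPolySpace.2 ⟨contDiff_star hf.1, by
    rw [diffOp_star, (mem_expPolySpace.1 hf).2, star_zero]⟩

/-- The exponential function `x ↦ exp (μ (x - c))`. -/
noncomputable def shiftedExp (μ : ℂ) (c : ℝ) (x : ℝ) : ℂ := Complex.exp (μ * (x - c))

lemma shiftedExp_self (μ : ℂ) (c : ℝ) : shiftedExp μ c c = 1 := by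
  simp [shiftedExp]

lemma shiftedExp_ne_zero (μ : ℂ) (c x : ℝ) : shiftedExp μ c x ≠ 0 := Complex.exp_ne_zero _

lemma shiftedExp_mul_neg (μ : ℂ) (c x : ℝ) : shiftedExp μ c x * shiftedExp (-μ) c x = 1 := by
  simp [shiftedExp, ← Complex.exp_add]

lemma shiftedExp_ofReal (r c x : ℝ) : shiftedExp r c x = (Real.exp (r * (x - c)) : ℝ) := by
  simp [shiftedExp]

lemma star_shiftedExp (μ : ℂ) (c : ℝ) : star (shiftedExp μ c) = shiftedExp (star μ) c := by
  funext x
  simp [shiftedExp, ← Complex.exp_conj]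

lemma isSelfAdjoint_shiftedExp (r c : ℝ) : IsSelfAdjoint (shiftedExp r c) := by
  rw [IsSelfAdjoint, star_shiftedExp, RCLike.star_def, Complex.conj_ofReal]

lemma hasDerivAt_shiftedExp (μ : ℂ) (c x : ℝ) :
    HasDerivAt (shiftedExp μ c) (μ * shiftedExp μ c x) x := by
  have h : HasDerivAt (fun y : ℝ => μ * ((y : ℂ) - c)) (μ * 1) x :=
    (Complex.ofRealCLM.hasDerivAt.sub_const (c : ℂ)).const_mul μ
  exact h.cexp.congr_deriv (by rw [mul_one, mul_comm, shiftedExp])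

lemma contDiff_shiftedExp (μ : ℂ) (c : ℝ) : ContDiff ℝ ∞ (shiftedExp μ c) :=
  Complex.contDiff_exp.comp
    (contDiff_const.mul (Complex.ofRealCLM.contDiff.sub contDiff_const))

lemma firstOrder_shiftedExp (μ ν : ℂ) (c : ℝ) :
    firstOrder ν (shiftedExp μ c) = (μ - ν) • shiftedExp μ c := by
  funext x
  simp only [firstOrder_apply, (hasDerivAt_shiftedExp μ c x).deriv, Pi.smul_apply, smul_eq_mul,
    sub_mul]

lemma diffOp_shiftedExp (Λ : List ℂ) (μ : ℂ) (c : ℝ) :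
    diffOp Λ (shiftedExp μ c) = (Λ.map (μ - ·)).prod • shiftedExp μ c := by
  induction Λ with
  | nil => simp [diffOp]
  | cons ν Λ ih =>
    rw [diffOp_cons, ih, firstOrder_smul, firstOrder_shiftedExp, smul_smul, List.map_cons,
      List.prod_cons, mul_comm]

lemma shiftedExp_mem_expPolySpace_iff {c : ℝ} : shiftedExp μ c ∈ expPolySpace Λ ↔ μ ∈ Λ := by
  have hne : shiftedExp μ c ≠ 0 := fun h => shiftedExp_ne_zero μ c c (congrFun h c)
  simp [mem_expPolySpace, contDiff_shiftedExp, diffOp_shiftedExp, hne, List.prod_eq_zero_iff,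
    sub_eq_zero]

/-- Variation of constants. -/
lemma exists_firstOrder_eq (μ : ℂ) (hg : ContDiff ℝ ∞ g) (a : ℝ) (c : ℂ) :
    ∃ f, ContDiff ℝ ∞ f ∧ firstOrder μ f = g ∧ f a = c := by
  set h : ℝ → ℂ := shiftedExp (-μ) a * g
  set G : ℝ → ℂ := fun x => ∫ t in a..x, h t
  have hh : ContDiff ℝ ∞ h := (contDiff_shiftedExp (-μ) a).mul hg
  have hG (x : ℝ) : HasDerivAt G (h x) x :=
    intervalIntegral.integral_hasDerivAt_right (hh.continuous.intervalIntegrable _ _)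
      (hh.continuous.stronglyMeasurableAtFilter _ _) hh.continuous.continuousAt
  have hG_smooth : ContDiff ℝ ∞ G := contDiff_infty_iff_deriv.2
    ⟨fun x => (hG x).differentiableAt, by rwa [funext fun x => (hG x).deriv]⟩
  refine ⟨shiftedExp μ a * (fun x => c + G x),
    (contDiff_shiftedExp μ a).mul (contDiff_const.add hG_smooth), ?_, ?_⟩
  · funext x
    have hd := ((hasDerivAt_shiftedExp μ a x).mul ((hG x).const_add c)).deriv
    simp only [firstOrder_apply, hd, h, Pi.mul_apply]
    linear_combination g x * shiftedExp_mul_neg μ a x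
  · simp [G, shiftedExp_self]

lemma eq_smul_shiftedExp (hf : ContDiff ℝ ∞ f) (h : firstOrder μ f = 0) (c : ℝ) :
    f = f c • shiftedExp μ c := by
  have hd (y : ℝ) : HasDerivAt (f * shiftedExp (-μ) c) 0 y := by
    refine ((hasDerivAt_of_contDiff hf y).mul (hasDerivAt_shiftedExp (-μ) c y)).congr_deriv ?_
    have hy : deriv f y - μ * f y = 0 := congrFun h y
    linear_combination shiftedExp (-μ) c y * hy
  funext x
  have hconst : f x * shiftedExp (-μ) c x = f c * shiftedExp (-μ) c c :=
    is_const_of_deriv_eq_zero (fun y => (hd y).differentiableAt) (fun y => (hd y).deriv) x c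
  rw [shiftedExp_self, mul_one] at hconst
  rw [Pi.smul_apply, smul_eq_mul, ← hconst, mul_assoc, mul_comm (shiftedExp _ _ _),
    shiftedExp_mul_neg, mul_one]

lemma eq_zero_of_firstOrder_eq_zero {c : ℝ} (hf : ContDiff ℝ ∞ f) (h : firstOrder μ f = 0)
    (hc : f c = 0) : f = 0 := by
  rw [eq_smul_shiftedExp hf h c, hc, zero_smul]

lemma perm_of_expPolySpace_subset (hlen : Λ.length = Λ'.length)
    (h : expPolySpace Λ ⊆ expPolySpace Λ') : Λ.Perm Λ' := by
  induction Λ generalizing Λ' with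
  | nil => rw [List.length_eq_zero_iff.1 hlen.symm]
  | cons μ Λ ih =>
    have hμ : μ ∈ Λ' := shiftedExp_mem_expPolySpace_iff.1
      (h (shiftedExp_mem_expPolySpace_iff (c := 0).2 List.mem_cons_self))
    have hperm := List.perm_cons_erase hμ
    refine (List.Perm.cons μ (ih ?_ fun g hg => ?_)).trans hperm.symm
    · rw [List.length_erase_of_mem hμ, ← hlen, List.length_cons, Nat.add_sub_cancel]
    · obtain ⟨f, hf, rfl, -⟩ := exists_firstOrder_eq μ hg.1 0 0
      have hf' : f ∈ expPolySpace Λ' := h (mem_expPolySpace_cons.2 ⟨hf, hg⟩)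
      rw [expPolySpace_perm hperm] at hf'
      exact (mem_expPolySpace_cons.1 hf').2

lemma perm_map_star_of_closedUnderConj (h : ClosedUnderConj (expPolySpace Λ)) :
    (Λ.map star).Perm Λ := by
  refine perm_of_expPolySpace_subset (List.length_map _) fun f hf => ?_
  have hstar : star f ∈ expPolySpace Λ := by
    simpa [Function.comp_def] using star_mem_expPolySpace hf
  simpa using h _ hstar

end ExpPoly

/-! ### Zeros with multiplicity -/

section Zeros

variable {μ : ℂ} {Λ : List ℂ} {f g : ℝ → ℂ} {k : ℕ} {c : ℝ}

/-- `f` has a zero of order at least `k` at `c`. -/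
def VanishesToOrder (f : ℝ → ℂ) (k : ℕ) (c : ℝ) : Prop := ∀ i < k, iteratedDeriv i f c = 0

lemma contDiffAt_natCast (hf : ContDiff ℝ ∞ f) (i : ℕ) (c : ℝ) : ContDiffAt ℝ i f c :=
  (contDiff_infty.1 hf i).contDiffAt

lemma vanishesToOrder_succ :
    VanishesToOrder f (k + 1) c ↔ f c = 0 ∧ VanishesToOrder (deriv f) k c := by
  simp only [VanishesToOrder, Nat.forall_lt_succ_left, iteratedDeriv_zero, iteratedDeriv_succ']

lemma vanishesToOrder_one : VanishesToOrder f 1 c ↔ f c = 0 := by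
  simp [VanishesToOrder]

lemma VanishesToOrder.mono {l : ℕ} (h : VanishesToOrder f k c) (hl : l ≤ k) :
    VanishesToOrder f l c :=
  fun i hi => h i (hi.trans_le hl)

lemma VanishesToOrder.apply_eq_zero (h : VanishesToOrder f k c) (hk : 0 < k) : f c = 0 := by
  simpa using h 0 hk

lemma VanishesToOrder.sub (hf : ContDiff ℝ ∞ f) (hg : ContDiff ℝ ∞ g)
    (hfk : VanishesToOrder f k c) (hgk : VanishesToOrder g k c) :
    VanishesToOrder (f - g) k c := fun i hi => by
  rw [iteratedDeriv_sub (contDiffAt_natCast hf i c) (contDiffAt_natCast hg i c), hfk i hi,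
    hgk i hi, sub_zero]

lemma VanishesToOrder.add (hf : ContDiff ℝ ∞ f) (hg : ContDiff ℝ ∞ g)
    (hfk : VanishesToOrder f k c) (hgk : VanishesToOrder g k c) :
    VanishesToOrder (f + g) k c := fun i hi => by
  rw [iteratedDeriv_add (contDiffAt_natCast hf i c) (contDiffAt_natCast hg i c), hfk i hi,
    hgk i hi, add_zero]

lemma VanishesToOrder.smul (z : ℂ) (h : VanishesToOrder f k c) : VanishesToOrder (z • f) k c :=
  fun i hi => by rw [iteratedDeriv_const_smul_field, h i hi, smul_zero]

lemma iteratedDeriv_star (i : ℕ) (f : ℝ → ℂ) :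
    iteratedDeriv i (star f) = star (iteratedDeriv i f) := by
  induction i with
  | zero => rfl
  | succ i ih => rw [iteratedDeriv_succ, ih, deriv_star, iteratedDeriv_succ]

lemma VanishesToOrder.star (h : VanishesToOrder f k c) : VanishesToOrder (star f) k c :=
  fun i hi => by rw [iteratedDeriv_star, Pi.star_apply, h i hi, star_zero]

lemma iteratedDeriv_firstOrder (μ : ℂ) (hf : ContDiff ℝ ∞ f) (i : ℕ) (c : ℝ) :
    iteratedDeriv i (firstOrder μ f) c = iteratedDeriv (i + 1) f c - μ * iteratedDeriv i f c := by
  rw [firstOrder, iteratedDeriv_sub (contDiffAt_natCast (contDiff_deriv hf) i c)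
    (contDiffAt_natCast (f := μ • f) (hf.const_smul μ) i c), iteratedDeriv_const_smul_field,
    ← iteratedDeriv_succ', smul_eq_mul]

lemma VanishesToOrder.firstOrder (hf : ContDiff ℝ ∞ f) (h : VanishesToOrder f (k + 1) c) (μ : ℂ) :
    VanishesToOrder (firstOrder μ f) k c := fun i hi => by
  rw [iteratedDeriv_firstOrder μ hf, h i (by omega), h (i + 1) (by omega), mul_zero, sub_zero]

lemma VanishesToOrder.mul_left (hf : ContDiff ℝ ∞ f) (hg : ContDiff ℝ ∞ g)
    (h : VanishesToOrder f k c) : VanishesToOrder (g * f) k c := fun i hi => by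
  rw [iteratedDeriv_mul (contDiffAt_natCast hg i c) (contDiffAt_natCast hf i c)]
  exact Finset.sum_eq_zero fun j _ => by rw [h (i - j) (by omega), mul_zero]

lemma VanishesToOrder.of_mul_left (hf : ContDiff ℝ ∞ f) (hg : ContDiff ℝ ∞ g) (hgc : g c ≠ 0)
    (h : VanishesToOrder (g * f) k c) : VanishesToOrder f k c := by
  intro i
  induction i using Nat.strong_induction_on with
  | _ i ih =>
    intro hi
    have hmul := h i hi
    rw [iteratedDeriv_mul (contDiffAt_natCast hg i c) (contDiffAt_natCast hf i c),
      Finset.sum_range_succ', Finset.sum_eq_zero, zero_add] at hmul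
    · simpa [hgc] using hmul
    · intro j hj
      have := Finset.mem_range.1 hj
      rw [ih (i - (j + 1)) (by omega) (by omega), mul_zero]

theorem eq_zero_of_vanishesToOrder (hf : f ∈ expPolySpace Λ)
    (h : VanishesToOrder f Λ.length c) : f = 0 := by
  induction Λ generalizing f with
  | nil => exact (mem_expPolySpace.1 hf).2
  | cons μ Λ ih =>
    exact eq_zero_of_firstOrder_eq_zero hf.1 (ih (mem_expPolySpace_cons.1 hf).2
      (h.firstOrder hf.1 μ)) (h.apply_eq_zero (Nat.succ_pos _))

/-- `f` has at least `N` zeros in `I`, counted with multiplicity: there is a multiset of `N` points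
of `I` in which no point occurs more often than its order as a zero of `f`. -/
def HasZerosGE (I : Set ℝ) (f : ℝ → ℂ) (N : ℕ) : Prop :=
  ∃ s : Multiset ℝ, N ≤ s.card ∧ ∀ z ∈ s, z ∈ I ∧ VanishesToOrder f (s.count z) z

lemma HasZerosGE.exists_eq_zero {I : Set ℝ} {N : ℕ} (h : HasZerosGE I f N) (hN : 0 < N) :
    ∃ z ∈ I, f z = 0 := by
  obtain ⟨s, hs, hz⟩ := h
  obtain ⟨z, hzs⟩ := Multiset.card_pos_iff_exists_mem.1 (hN.trans_le hs)
  exact ⟨z, (hz z hzs).1, (hz z hzs).2.apply_eq_zero (Multiset.count_pos.2 hzs)⟩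

lemma HasZerosGE.of_mul_left {I : Set ℝ} {N : ℕ} (hf : ContDiff ℝ ∞ f) (hg : ContDiff ℝ ∞ g)
    (hgI : ∀ x ∈ I, g x ≠ 0) (h : HasZerosGE I (g * f) N) : HasZerosGE I f N := by
  obtain ⟨s, hs, hz⟩ := h
  exact ⟨s, hs, fun z hzs => ⟨(hz z hzs).1, (hz z hzs).2.of_mul_left hf hg (hgI z (hz z hzs).1)⟩⟩

lemma hasZerosGE_of_endpoints {a b : ℝ} (hab : a < b) {l N : ℕ}
    (ha : VanishesToOrder f k a) (hb : VanishesToOrder f l b) (hN : N ≤ k + l) :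
    HasZerosGE (Set.Icc a b) f N := by
  refine ⟨Multiset.replicate k a + Multiset.replicate l b, by simpa using hN, fun z hz => ?_⟩
  rcases Multiset.mem_add.1 hz with h | h
  · rw [Multiset.eq_of_mem_replicate h]
    exact ⟨Set.left_mem_Icc.2 hab.le, by simpa [Multiset.count_replicate, hab.ne'] using ha⟩
  · rw [Multiset.eq_of_mem_replicate h]
    exact ⟨Set.right_mem_Icc.2 hab.le, by simpa [Multiset.count_replicate, hab.ne] using hb⟩

lemma hasZerosGE_of_endpoints_of_mem_Ioo {a b x : ℝ} (hx : x ∈ Set.Ioo a b) {l N : ℕ}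
    (ha : VanishesToOrder f k a) (hb : VanishesToOrder f l b) (hfx : f x = 0)
    (hN : N ≤ k + l + 1) : HasZerosGE (Set.Icc a b) f N := by
  have hab : a < b := hx.1.trans hx.2
  refine ⟨x ::ₘ (Multiset.replicate k a + Multiset.replicate l b), by simpa using hN,
    fun z hz => ?_⟩
  rcases Multiset.mem_cons.1 hz with rfl | hz
  · exact ⟨Set.Ioo_subset_Icc_self hx, by
      simpa [Multiset.count_replicate, hx.1.ne, hx.2.ne', vanishesToOrder_one] using hfx⟩
  rcases Multiset.mem_add.1 hz with h | h
  · rw [Multiset.eq_of_mem_replicate h]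
    exact ⟨Set.left_mem_Icc.2 hab.le, by
      simpa [Multiset.count_replicate, Multiset.count_cons, hab.ne', hx.1.ne] using ha⟩
  · rw [Multiset.eq_of_mem_replicate h]
    exact ⟨Set.right_mem_Icc.2 hab.le, by
      simpa [Multiset.count_replicate, Multiset.count_cons, hab.ne, hx.2.ne'] using hb⟩

/-- The Wronskian `f' g - f g'`. -/
noncomputable def wronskian (f g : ℝ → ℂ) : ℝ → ℂ := deriv f * g - f * deriv g

lemma contDiff_wronskian (hf : ContDiff ℝ ∞ f) (hg : ContDiff ℝ ∞ g) :
    ContDiff ℝ ∞ (wronskian f g) :=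
  ((contDiff_deriv hf).mul hg).sub (hf.mul (contDiff_deriv hg))

lemma wronskian_eq_firstOrder (μ : ℂ) (f g : ℝ → ℂ) :
    wronskian f g = g * firstOrder μ f - f * firstOrder μ g := by
  simp only [wronskian, firstOrder, mul_sub, mul_smul_comm, mul_comm]
  abel

/-- Abel's identity. -/
lemma firstOrder_add_wronskian (μ ν : ℂ) (hf : ContDiff ℝ ∞ f) (hg : ContDiff ℝ ∞ g) :
    firstOrder (μ + ν) (wronskian f g) =
      g * firstOrder ν (firstOrder μ f) - f * firstOrder ν (firstOrder μ g) := by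
  funext x
  have hf' := hasDerivAt_of_contDiff hf x
  have hg' := hasDerivAt_of_contDiff hg x
  have hf'' := hasDerivAt_of_contDiff (contDiff_deriv hf) x
  have hg'' := hasDerivAt_of_contDiff (contDiff_deriv hg) x
  have hw : deriv (wronskian f g) x = _ := ((hf''.mul hg').sub (hf'.mul hg'')).deriv
  rw [firstOrder_apply, hw]
  simp only [firstOrder_apply, wronskian, Pi.sub_apply, Pi.mul_apply, deriv_firstOrder μ hf,
    deriv_firstOrder μ hg]
  ring

end Zeros

section Rolle

variable {f g : ℝ → ℂ} {k : ℕ} {c : ℝ}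

lemma ofReal_re_of_isSelfAdjoint (hf : IsSelfAdjoint f) (x : ℝ) : ((f x).re : ℂ) = f x :=
  Complex.conj_eq_iff_re.1 (Pi.isSelfAdjoint.1 hf x)

lemma isSelfAdjoint_deriv (hf : IsSelfAdjoint f) : IsSelfAdjoint (deriv f) := by
  rw [IsSelfAdjoint, ← deriv_star, hf.star_eq]

lemma isSelfAdjoint_iteratedDeriv (hf : IsSelfAdjoint f) (i : ℕ) :
    IsSelfAdjoint (iteratedDeriv i f) := by
  rw [IsSelfAdjoint, ← iteratedDeriv_star, hf.star_eq]

lemma isSelfAdjoint_firstOrder (r : ℝ) (hf : IsSelfAdjoint f) :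
    IsSelfAdjoint (firstOrder r f) := by
  have h := firstOrder_star (r : ℂ) f
  rw [RCLike.star_def, Complex.conj_ofReal, hf.star_eq] at h
  exact h.symm

lemma isSelfAdjoint_wronskian (hf : IsSelfAdjoint f) (hg : IsSelfAdjoint g) :
    IsSelfAdjoint (wronskian f g) :=
  ((isSelfAdjoint_deriv hf).mul hg).sub (hf.mul (isSelfAdjoint_deriv hg))

lemma VanishesToOrder.wronskian (hf : ContDiff ℝ ∞ f) (hg : ContDiff ℝ ∞ g)
    (h : VanishesToOrder f (k + 1) c) : VanishesToOrder (wronskian f g) k c := by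
  have hfirst : VanishesToOrder (g * deriv f) k c :=
    (vanishesToOrder_succ.1 h).2.mul_left (contDiff_deriv hf) hg
  have hsecond : VanishesToOrder (deriv g * f) k c :=
    (h.mono k.le_succ).mul_left hf (contDiff_deriv hg)
  rw [_root_.wronskian, mul_comm (deriv f), mul_comm f]
  exact hfirst.sub (hg.mul (contDiff_deriv hf)) ((contDiff_deriv hg).mul hf) hsecond

/-- The Wronskian is `g ^ 2` times the derivative of the real function `f / g`. -/
lemma exists_wronskian_eq_zero (hf : ContDiff ℝ ∞ f) (hg : ContDiff ℝ ∞ g)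
    (hf_sa : IsSelfAdjoint f) (hg_sa : IsSelfAdjoint g) {x y : ℝ} (hxy : x < y)
    (hg0 : ∀ z ∈ Set.Icc x y, g z ≠ 0) (hx : f x = 0) (hy : f y = 0) :
    ∃ z ∈ Set.Ioo x y, wronskian f g z = 0 := by
  have hquot (z : ℝ) (hz : z ∈ Set.Icc x y) :
      HasDerivAt (fun t => (f t / g t).re) (wronskian f g z / g z ^ 2).re z :=
    Complex.reCLM.hasFDerivAt.comp_hasDerivAt z
      ((hasDerivAt_of_contDiff hf z).div (hasDerivAt_of_contDiff hg z) (hg0 z hz))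
  obtain ⟨z, hz, hre⟩ := exists_hasDerivAt_eq_zero hxy
    (fun z hz => (hquot z hz).continuousAt.continuousWithinAt) (by simp [hx, hy])
    fun z hz => hquot z (Set.Ioo_subset_Icc_self hz)
  have hreal : IsSelfAdjoint (wronskian f g z / g z ^ 2) :=
    (Pi.isSelfAdjoint.1 (isSelfAdjoint_wronskian hf_sa hg_sa) z).div
      ((Pi.isSelfAdjoint.1 hg_sa z).pow 2)
  rw [← Complex.ofReal_eq_zero, Complex.conj_eq_iff_re.1 hreal] at hre
  exact ⟨z, hz, (div_eq_zero_iff.1 hre).resolve_right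
    (pow_ne_zero 2 (hg0 z (Set.Ioo_subset_Icc_self hz)))⟩

lemma exists_finset_interleaving {α : Type*} [LinearOrder α] {d : Finset α} {P : α → Prop}
    (h : ∀ x ∈ d, ∀ y ∈ d, x < y → ∃ z ∈ Set.Ioo x y, P z) :
    ∃ t : Finset α, (∀ z ∈ t, P z) ∧ Disjoint t d ∧ d.card ≤ t.card + 1 := by
  classical
  choose! z hz using h
  let t := ((d ×ˢ d).filter fun p => p.1 < p.2).image fun p => z p.1 p.2
  refine ⟨t \ d, fun w hw => ?_, Finset.sdiff_disjoint,
    Finset.card_le_sdiff_of_interleaved fun x hx y hy hxy _ =>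
      ⟨z x y, Finset.mem_image.2 ⟨(x, y), by simp [hx, hy, hxy]⟩, (hz x hx y hy hxy).1⟩⟩
  obtain ⟨p, hp, rfl⟩ := Finset.mem_image.1 (Finset.mem_sdiff.1 hw).1
  simp only [Finset.mem_filter, Finset.mem_product] at hp
  exact (hz p.1 hp.1.1 p.2 hp.1.2 hp.2).2

theorem HasZerosGE.wronskian {I : Set ℝ} [hI : I.OrdConnected] {N : ℕ} (hf : ContDiff ℝ ∞ f)
    (hg : ContDiff ℝ ∞ g) (hf_sa : IsSelfAdjoint f) (hg_sa : IsSelfAdjoint g)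
    (hg0 : ∀ x ∈ I, g x ≠ 0) (h : HasZerosGE I f (N + 1)) :
    HasZerosGE I (wronskian f g) N := by
  obtain ⟨s, hcard, hs⟩ := h
  have hzero (x : ℝ) (hx : x ∈ s) : f x = 0 :=
    (hs x hx).2.apply_eq_zero (Multiset.count_pos.2 hx)
  obtain ⟨t, ht, htd, hle⟩ : ∃ t : Finset ℝ, (∀ z ∈ t, z ∈ I ∧ _root_.wronskian f g z = 0) ∧
      Disjoint t s.toFinset ∧ s.toFinset.card ≤ t.card + 1 := by
    refine exists_finset_interleaving fun x hx y hy hxy => ?_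
    rw [Multiset.mem_toFinset] at hx hy
    have hI' : Set.Icc x y ⊆ I := hI.out (hs x hx).1 (hs y hy).1
    obtain ⟨z, hz, hwz⟩ := exists_wronskian_eq_zero hf hg hf_sa hg_sa hxy
      (fun z hz => hg0 z (hI' hz)) (hzero x hx) (hzero y hy)
    exact ⟨z, hz, hI' (Set.Ioo_subset_Icc_self hz), hwz⟩
  have hle_s : s.toFinset.val ≤ s := Multiset.dedup_le s
  refine ⟨s - s.toFinset.val + t.val, ?_, fun z hz => ?_⟩
  · have := Multiset.card_le_card hle_s
    rw [Multiset.card_add, Multiset.card_sub hle_s]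
    simp only [Finset.card_val] at this ⊢
    omega
  · rw [Multiset.count_add, Multiset.count_sub]
    by_cases hzt : z ∈ t
    · have hzs : z ∉ s := fun h => Finset.disjoint_left.1 htd hzt (Multiset.mem_toFinset.2 h)
      rw [Multiset.count_eq_zero_of_notMem hzs, Multiset.count_eq_one_of_mem t.nodup hzt,
        Nat.zero_sub, zero_add, vanishesToOrder_one]
      exact ht z hzt
    · have hzs : z ∈ s := Multiset.mem_of_le (Multiset.sub_le_self _ _)
        ((Multiset.mem_add.1 hz).resolve_right hzt)
      rw [Multiset.count_eq_zero_of_notMem hzt, add_zero,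
        Multiset.count_eq_one_of_mem s.toFinset.nodup (Multiset.mem_toFinset.2 hzs)]
      refine ⟨(hs z hzs).1, VanishesToOrder.wronskian hf hg ?_⟩
      rw [Nat.sub_add_cancel (Multiset.count_pos.2 hzs)]
      exact (hs z hzs).2

lemma HasZerosGE.firstOrder {I : Set ℝ} [I.OrdConnected] {N : ℕ} (hf : ContDiff ℝ ∞ f)
    (hf_sa : IsSelfAdjoint f) (r : ℝ) (h : HasZerosGE I f (N + 1)) :
    HasZerosGE I (firstOrder r f) N := by
  have hw := h.wronskian hf (contDiff_shiftedExp r 0) hf_sa (isSelfAdjoint_shiftedExp r 0)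
    fun x _ => shiftedExp_ne_zero _ _ x
  rw [wronskian_eq_firstOrder r, firstOrder_shiftedExp, sub_self, zero_smul, mul_zero,
    sub_zero] at hw
  exact hw.of_mul_left (contDiff_firstOrder r hf) (contDiff_shiftedExp r 0)
    fun x _ => shiftedExp_ne_zero _ _ x

end Rolle

/-! ### The Chebyshev property -/

section Chebyshev

variable {a b r : ℝ} {μ : ℂ} {Λ Λ' : List ℂ} {f : ℝ → ℂ}

/-- The vectors `Λ` of the theorem: nonreal eigenvalues come in conjugate pairs, and `b - a` is
less than `π / |Im μ|` for each of them. -/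
structure Admissible (a b : ℝ) (Λ : List ℂ) : Prop where
  lt : a < b
  perm_star : (Λ.map star).Perm Λ
  im_lt : ∀ μ ∈ Λ, |μ.im| * (b - a) < Real.pi

namespace Admissible

lemma perm (h : Admissible a b Λ) (hp : Λ.Perm Λ') : Admissible a b Λ' :=
  ⟨h.lt, ((hp.map _).symm.trans h.perm_star).trans hp, fun μ hμ => h.im_lt μ (hp.mem_iff.2 hμ)⟩

lemma of_cons (h : Admissible a b ((r : ℂ) :: Λ)) : Admissible a b Λ := by
  refine ⟨h.lt, ?_, fun ν hν => h.im_lt ν (List.mem_cons_of_mem _ hν)⟩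
  simpa using h.perm_star

lemma cons (h : Admissible a b Λ) (r : ℝ) : Admissible a b ((r : ℂ) :: Λ) :=
  ⟨h.lt, by simpa using h.perm_star, by simpa [Real.pi_pos] using h.im_lt⟩

lemma exists_perm_star_cons (h : Admissible a b (μ :: Λ)) (hμ : μ.im ≠ 0) :
    ∃ Λ', Λ.Perm (star μ :: Λ') ∧ Admissible a b Λ' := by
  have hmem : star μ ∈ Λ :=
    (List.mem_cons.1 (h.perm_star.mem_iff.1 (by simp : star μ ∈ (μ :: Λ).map star))).resolve_left
      fun hstar => hμ (Complex.conj_eq_iff_im.1 hstar)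
  have hp := List.perm_cons_erase hmem
  refine ⟨_, hp, h.lt, ?_, fun ν hν =>
    h.im_lt ν (List.mem_cons_of_mem _ (List.mem_of_mem_erase hν))⟩
  have hp' := (h.perm (hp.cons μ)).perm_star
  simp only [List.map_cons, star_star] at hp'
  exact ((List.Perm.swap _ _ _).trans hp').cons_inv.cons_inv

theorem induction {P : List ℂ → Prop} (h : Admissible a b Λ) (nil : P [])
    (real : ∀ (r : ℝ) (Λ : List ℂ), P Λ → P ((r : ℂ) :: Λ))
    (pair : ∀ (μ : ℂ) (Λ : List ℂ), |μ.im| * (b - a) < Real.pi → P Λ → P (μ :: star μ :: Λ))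
    (perm : ∀ Λ Λ' : List ℂ, Λ.Perm Λ' → P Λ → P Λ') : P Λ := by
  induction hn : Λ.length using Nat.strong_induction_on generalizing Λ with
  | _ n ih =>
    rcases Λ with - | ⟨μ, Λ⟩
    · exact nil
    by_cases hμ : μ.im = 0
    · obtain ⟨r, rfl⟩ : ∃ r : ℝ, (r : ℂ) = μ := ⟨μ.re, Complex.ext rfl hμ.symm⟩
      exact real r Λ (ih Λ.length (by simp [← hn]) h.of_cons rfl)
    · obtain ⟨Λ', hp, hΛ'⟩ := h.exists_perm_star_cons hμ
      have hlen : Λ'.length < n := by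
        rw [← hn, List.length_cons, hp.length_eq, List.length_cons]
        omega
      exact perm _ _ (hp.symm.cons μ)
        (pair μ Λ' (h.im_lt μ List.mem_cons_self) (ih _ hlen hΛ' rfl))

end Admissible

/-- The real functions in `E_Λ` form a Chebyshev space on `[a, b]`, in the strong sense that zeros
are counted with multiplicity. -/
def IsChebyshev (a b : ℝ) (Λ : List ℂ) : Prop :=
  ∀ f ∈ expPolySpace Λ, IsSelfAdjoint f → HasZerosGE (Set.Icc a b) f Λ.length → f = 0

lemma IsChebyshev.real_cons (h : IsChebyshev a b Λ) (r : ℝ) :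
    IsChebyshev a b ((r : ℂ) :: Λ) := by
  intro f hf hf_sa hz
  have hD : firstOrder r f = 0 := h _ (mem_expPolySpace_cons.1 hf).2
    (isSelfAdjoint_firstOrder r hf_sa) (hz.firstOrder hf.1 hf_sa r)
  obtain ⟨p, -, hp⟩ := hz.exists_eq_zero (Nat.succ_pos _)
  exact eq_zero_of_firstOrder_eq_zero hf.1 hD hp

lemma shiftedExp_add_star_ne_zero (hμ : |μ.im| * (b - a) < Real.pi) {x : ℝ}
    (hx : x ∈ Set.Icc a b) :
    (shiftedExp μ ((a + b) / 2) + star (shiftedExp μ ((a + b) / 2))) x ≠ 0 := by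
  have hdist : |x - (a + b) / 2| ≤ (b - a) / 2 :=
    abs_le.2 ⟨by linarith [hx.1], by linarith [hx.2]⟩
  have harg : |μ.im * (x - (a + b) / 2)| < Real.pi / 2 := by
    rw [abs_mul]
    calc |μ.im| * |x - (a + b) / 2| ≤ |μ.im| * ((b - a) / 2) := by gcongr
      _ < Real.pi / 2 := by linarith
  have hcos := Real.cos_pos_of_mem_Ioo ⟨(abs_lt.1 harg).1, (abs_lt.1 harg).2⟩
  rw [Pi.add_apply, Pi.star_apply, RCLike.star_def, Complex.add_conj, Complex.ofReal_ne_zero,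
    shiftedExp, Complex.exp_re]
  have him : (μ * ((x : ℂ) - ((a + b) / 2 : ℝ))).im = μ.im * (x - (a + b) / 2) := by
    simp [Complex.mul_im]
  rw [him]
  positivity

lemma firstOrder_firstOrder_shiftedExp_add_star (μ : ℂ) (m : ℝ) :
    firstOrder (star μ) (firstOrder μ (shiftedExp μ m + star (shiftedExp μ m))) = 0 := by
  rw [star_shiftedExp, firstOrder_add μ (contDiff_shiftedExp _ _) (contDiff_shiftedExp _ _),
    firstOrder_shiftedExp, sub_self, zero_smul, zero_add, firstOrder_shiftedExp, firstOrder_smul,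
    firstOrder_shiftedExp, sub_self, zero_smul, smul_zero]

lemma isSelfAdjoint_firstOrder_firstOrder (μ : ℂ) (hf : ContDiff ℝ ∞ f) (hf_sa : IsSelfAdjoint f) :
    IsSelfAdjoint (firstOrder (star μ) (firstOrder μ f)) := by
  rw [IsSelfAdjoint, ← firstOrder_star, ← firstOrder_star, star_star, hf_sa.star_eq,
    firstOrder_comm _ _ hf]

/-- The Wronskian `w` of `f` with the real solution `c` of `(D - μ) (D - μ̄) c = 0` satisfies
`(D - 2 Re μ) w = c (D - μ̄) (D - μ) f`, so two applications of Rolle's theorem remove both `μ`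
and its conjugate. -/
lemma IsChebyshev.pair_cons (h : IsChebyshev a b Λ) (hμ : |μ.im| * (b - a) < Real.pi) :
    IsChebyshev a b (μ :: star μ :: Λ) := by
  intro f hf hf_sa hz
  obtain ⟨hf_smooth, hf₁⟩ := mem_expPolySpace_cons.1 hf
  set c := shiftedExp μ ((a + b) / 2) + star (shiftedExp μ ((a + b) / 2))
  have hc : ContDiff ℝ ∞ c :=
    (contDiff_shiftedExp _ _).add (contDiff_star (contDiff_shiftedExp _ _))
  have hc_sa : IsSelfAdjoint c := .add_star_self _
  have hc0 (x : ℝ) (hx : x ∈ Set.Icc a b) : c x ≠ 0 := shiftedExp_add_star_ne_zero hμ hx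
  have hDc : firstOrder (star μ) (firstOrder μ c) = 0 :=
    firstOrder_firstOrder_shiftedExp_add_star μ _
  have hw : ContDiff ℝ ∞ (wronskian f c) := contDiff_wronskian hf_smooth hc
  have hwz : HasZerosGE (Set.Icc a b) (wronskian f c) (Λ.length + 1) :=
    hz.wronskian hf_smooth hc hf_sa hc_sa hc0
  have hDw : firstOrder ((2 * μ.re : ℝ) : ℂ) (wronskian f c) =
      c * firstOrder (star μ) (firstOrder μ f) := by
    rw [← Complex.add_conj, ← RCLike.star_def, firstOrder_add_wronskian _ _ hf_smooth hc, hDc,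
      mul_zero, sub_zero]
  have hDf : firstOrder (star μ) (firstOrder μ f) = 0 := by
    refine h _ (mem_expPolySpace_cons.1 hf₁).2
      (isSelfAdjoint_firstOrder_firstOrder μ hf_smooth hf_sa)
      (HasZerosGE.of_mul_left (contDiff_firstOrder _ hf₁.1) hc hc0 ?_)
    rw [← hDw]
    exact hwz.firstOrder hw (isSelfAdjoint_wronskian hf_sa hc_sa) _
  have hw0 : wronskian f c = 0 := by
    obtain ⟨q, -, hq⟩ := hwz.exists_eq_zero (Nat.succ_pos _)
    exact eq_zero_of_firstOrder_eq_zero hw (by rw [hDw, hDf, mul_zero]) hq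
  obtain ⟨p, hp, hfp⟩ := hz.exists_eq_zero (Nat.succ_pos _)
  have hf'p : deriv f p = 0 := by
    have hwp : deriv f p * c p - f p * deriv c p = 0 := congrFun hw0 p
    simpa [hfp, hc0 p hp] using hwp
  have hD : firstOrder μ f = 0 := eq_zero_of_firstOrder_eq_zero (c := p)
    hf₁.1 hDf (by rw [firstOrder_apply, hf'p, hfp, mul_zero, sub_zero])
  exact eq_zero_of_firstOrder_eq_zero hf_smooth hD hfp

theorem Admissible.isChebyshev (hΛ : Admissible a b Λ) : IsChebyshev a b Λ :=
  hΛ.induction (fun _ hf _ _ => (mem_expPolySpace.1 hf).2) (fun r _ h => h.real_cons r)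
    (fun _ _ hμ h => h.pair_cons hμ) fun Λ Λ' hp h => by
      rwa [IsChebyshev, ← expPolySpace_perm hp, ← hp.length_eq]

theorem eq_zero_of_vanishesToOrder_endpoints (hΛ : Admissible a b Λ) (hf : f ∈ expPolySpace Λ)
    {k l : ℕ} (hkl : Λ.length ≤ k + l) (ha : VanishesToOrder f k a) (hb : VanishesToOrder f l b) :
    f = 0 := by
  have hstar : star f ∈ expPolySpace Λ := by
    rw [← expPolySpace_perm hΛ.perm_star]
    exact star_mem_expPolySpace hf
  have hreal (z : ℂ) : z • f + star z • star f = 0 := by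
    have hsmooth := hf.1.const_smul z
    have hsmooth' := hstar.1.const_smul (star z)
    refine hΛ.isChebyshev _ ((expPolySubmodule Λ).add_mem
      ((expPolySubmodule Λ).smul_mem z hf) ((expPolySubmodule Λ).smul_mem _ hstar)) ?_
      (hasZerosGE_of_endpoints hΛ.lt ((ha.smul z).add hsmooth hsmooth' (ha.star.smul _))
        ((hb.smul z).add hsmooth hsmooth' (hb.star.smul _)) hkl)
    rw [← star_smul]
    exact .add_star_self _
  funext x
  have h1 : f x + star (f x) = 0 := by simpa using congrFun (hreal 1) x
  have hI : Complex.I * f x - Complex.I * star (f x) = 0 := by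
    simpa [sub_eq_add_neg] using congrFun (hreal Complex.I) x
  have h2 : f x - star (f x) = 0 := by
    rwa [← mul_sub, mul_eq_zero, or_iff_right Complex.I_ne_zero] at hI
  change f x = 0
  linear_combination (1 / 2) * h1 + (1 / 2) * h2

end Chebyshev

/-! ### Hermite interpolation and Bernstein bases -/

section BernsteinBasis

variable {a b c : ℝ} {Λ Λ' : List ℂ} {f g : ℝ → ℂ} {k l : ℕ}

lemma exists_mem_iteratedDeriv_eq (c : ℝ) (Λ : List ℂ) (u : ℕ → ℂ) :
    ∃ f ∈ expPolySpace Λ, ∀ i < Λ.length, iteratedDeriv i f c = u i := by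
  induction Λ generalizing u with
  | nil => exact ⟨0, (expPolySubmodule []).zero_mem, fun i hi => absurd hi (Nat.not_lt_zero i)⟩
  | cons μ Λ ih =>
    obtain ⟨g, hg, hgu⟩ := ih fun i => u (i + 1) - μ * u i
    obtain ⟨f, hf, rfl, hfc⟩ := exists_firstOrder_eq μ hg.1 c (u 0)
    refine ⟨f, mem_expPolySpace_cons.2 ⟨hf, hg⟩, fun i => ?_⟩
    induction i with
    | zero => simpa using hfc
    | succ i ihi =>
      intro hi
      have h := hgu i (Nat.lt_of_succ_lt_succ hi)
      rwa [iteratedDeriv_firstOrder μ hf, ihi (Nat.lt_of_succ_lt hi), sub_left_inj] at h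

/-- The `k`-jet at `c` of the elements of `E_Λ`: the derivatives of orders `0, …, k - 1`. -/
noncomputable def jet (Λ : List ℂ) (k : ℕ) (c : ℝ) : expPolySubmodule Λ →ₗ[ℂ] (Fin k → ℂ) where
  toFun f i := iteratedDeriv i (f : ℝ → ℂ) c
  map_add' f g := funext fun i =>
    iteratedDeriv_add (contDiffAt_natCast f.2.1 i c) (contDiffAt_natCast g.2.1 i c)
  map_smul' z f := funext fun _ => iteratedDeriv_const_smul_field z (f : ℝ → ℂ)

lemma jet_eq_zero_iff {f : expPolySubmodule Λ} :
    jet Λ k c f = 0 ↔ VanishesToOrder (f : ℝ → ℂ) k c :=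
  ⟨fun h i hi => congrFun h ⟨i, hi⟩, fun h => funext fun i => h i i.2⟩

lemma jet_bijective (Λ : List ℂ) (c : ℝ) : Function.Bijective (jet Λ Λ.length c) := by
  refine ⟨(injective_iff_map_eq_zero _).2 fun f hf =>
    Subtype.ext (eq_zero_of_vanishesToOrder f.2 (jet_eq_zero_iff.1 hf)), fun u => ?_⟩
  obtain ⟨f, hf, hfu⟩ :=
    exists_mem_iteratedDeriv_eq c Λ fun i => if h : i < Λ.length then u ⟨i, h⟩ else 0
  exact ⟨⟨f, hf⟩, funext fun i => (hfu i i.2).trans (dif_pos i.2)⟩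

theorem Admissible.exists_hermite_interpolant (hΛ : Admissible a b Λ) (hkl : k + l = Λ.length)
    (u v : ℕ → ℂ) :
    ∃ f ∈ expPolySpace Λ, (∀ i < k, iteratedDeriv i f a = u i) ∧
      ∀ i < l, iteratedDeriv i f b = v i := by
  let e := LinearEquiv.ofBijective _ (jet_bijective Λ a)
  have : FiniteDimensional ℂ (expPolySubmodule Λ) := e.symm.finiteDimensional
  have hinj : Function.Injective ((jet Λ k a).prod (jet Λ l b)) :=
    (injective_iff_map_eq_zero _).2 fun f hf => Subtype.ext <|
      eq_zero_of_vanishesToOrder_endpoints hΛ f.2 hkl.ge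
        (jet_eq_zero_iff.1 (congrArg Prod.fst hf)) (jet_eq_zero_iff.1 (congrArg Prod.snd hf))
  have hdim : Module.finrank ℂ (expPolySubmodule Λ) =
      Module.finrank ℂ ((Fin k → ℂ) × (Fin l → ℂ)) := by
    rw [e.finrank_eq]
    simp [hkl]
  obtain ⟨f, hf⟩ := (LinearMap.injective_iff_surjective_of_finrank_eq_finrank hdim).1 hinj
    (fun i => u i, fun i => v i)
  exact ⟨f, f.2, fun i hi => congrFun (congrArg Prod.fst hf) ⟨i, hi⟩,
    fun i hi => congrFun (congrArg Prod.snd hf) ⟨i, hi⟩⟩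

theorem Admissible.exists_isBernsteinBasis (hΛ : Admissible a b Λ) :
    ∃ p, IsBernsteinBasis Λ a b p := by
  have h (k : ℕ) (hk : k < Λ.length) : ∃ f ∈ expPolySpace Λ, HasZeroOfOrder f k a ∧
      HasZeroOfOrder f (Λ.length - 1 - k) b ∧ iteratedDeriv k f a = 1 := by
    obtain ⟨f, hf, hfa, hfb⟩ := hΛ.exists_hermite_interpolant
      (k := k + 1) (l := Λ.length - 1 - k) (by omega) (Pi.single k 1) 0
    have hfk : iteratedDeriv k f a = 1 := (hfa k k.lt_succ_self).trans (Pi.single_eq_same k 1)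
    have hfa' : VanishesToOrder f k a := fun i hi =>
      (hfa i (hi.trans k.lt_succ_self)).trans (Pi.single_eq_of_ne hi.ne 1)
    refine ⟨f, hf, ⟨hfa', by simp [hfk]⟩, ⟨hfb, fun hfb' => ?_⟩, hfk⟩
    have hf_zero : f = 0 := eq_zero_of_vanishesToOrder_endpoints hΛ hf
      (l := Λ.length - 1 - k + 1) (by omega) hfa' (Nat.forall_lt_succ_right.2 ⟨hfb, hfb'⟩)
    simp [hf_zero] at hfk
  choose! p hp using h
  exact ⟨p, hp⟩

lemma bernsteinBasis_perm (h : Λ.Perm Λ') (a b : ℝ) :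
    bernsteinBasis Λ a b = bernsteinBasis Λ' a b := by
  have hiff : IsBernsteinBasis Λ a b = IsBernsteinBasis Λ' a b := by
    funext p
    simp only [IsBernsteinBasis, h.length_eq, expPolySpace_perm h]
  rw [bernsteinBasis, hiff, bernsteinBasis]

lemma tendsto_div_pow_of_vanishesToOrder (hf : ContDiff ℝ ∞ f) (h : VanishesToOrder f l c) :
    Tendsto (fun x : ℝ => f x / (x - c) ^ l) (𝓝[≠] c) (𝓝 (iteratedDeriv l f c / l.factorial)) := by
  have htaylor (x : ℝ) : taylorWithinEval f l Set.univ c x =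
      (x - c) ^ l * (iteratedDeriv l f c / l.factorial) := by
    rw [taylor_within_apply, Finset.sum_range_succ, Finset.sum_eq_zero fun i hi => by
      rw [iteratedDerivWithin_univ, h i (Finset.mem_range.1 hi), smul_zero], zero_add,
      iteratedDerivWithin_univ, Complex.real_smul]
    push_cast
    ring
  have hrem := taylor_tendsto (f := f) (n := l) convex_univ (Set.mem_univ c)
    (hf.of_le (by exact_mod_cast le_top)).contDiffOn
  rw [nhdsWithin_univ] at hrem
  have hlim := (hrem.mono_left (nhdsWithin_le_nhds (s := {c}ᶜ))).add_const
    (iteratedDeriv l f c / (l.factorial : ℂ))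
  rw [zero_add] at hlim
  refine hlim.congr' ?_
  filter_upwards [self_mem_nhdsWithin] with x hx
  have hxc : ((x : ℂ) - c) ^ l ≠ 0 :=
    pow_ne_zero _ (sub_ne_zero.2 (Complex.ofReal_injective.ne hx))
  rw [htaylor, Complex.real_smul]
  push_cast
  field_simp
  ring

lemma boundaryLimit_eq (hf : ContDiff ℝ ∞ f) (hg : ContDiff ℝ ∞ g)
    (hfl : VanishesToOrder f l b) (hgl : HasZeroOfOrder g l b) :
    boundaryLimit f g b = iteratedDeriv l f b / iteratedDeriv l g b := by
  have hfac : (l.factorial : ℂ) ≠ 0 := by exact_mod_cast l.factorial_ne_zero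
  have hlim := (tendsto_div_pow_of_vanishesToOrder hf hfl).div
    (tendsto_div_pow_of_vanishesToOrder hg hgl.1) (div_ne_zero hgl.2 hfac)
  rw [div_div_div_cancel_right₀ hfac] at hlim
  refine Tendsto.limUnder_eq
    ((hlim.mono_left (nhdsWithin_mono b fun x hx => ne_of_lt hx)).congr' ?_)
  filter_upwards [self_mem_nhdsWithin] with x (hx : x < b)
  exact div_div_div_cancel_right₀
    (pow_ne_zero _ (sub_ne_zero.2 (Complex.ofReal_injective.ne hx.ne))) _ _

end BernsteinBasis

section BasisFunctions

variable {a b : ℝ} {Λ Λ' : List ℂ} {f : ℝ → ℂ} {k l : ℕ}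

lemma tendsto_re_div_pow_of_vanishesToOrder {c : ℝ} (hf : ContDiff ℝ ∞ f)
    (h : VanishesToOrder f l c) :
    Tendsto (fun x : ℝ => (f x).re / (x - c) ^ l) (𝓝[≠] c)
      (𝓝 ((iteratedDeriv l f c).re / l.factorial)) := by
  have hlim := (Complex.continuous_re.tendsto _).comp (tendsto_div_pow_of_vanishesToOrder hf h)
  simpa only [Function.comp_def, ← Complex.ofReal_sub, ← Complex.ofReal_pow, Complex.div_ofReal_re,
    Complex.div_natCast_re] using hlim

namespace Admissible

section

variable (hΛ : Admissible a b Λ) (hk : k < Λ.length)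

include hΛ hk

lemma bernsteinBasis_spec : bernsteinBasis Λ a b k ∈ expPolySpace Λ ∧
    HasZeroOfOrder (bernsteinBasis Λ a b k) k a ∧
    HasZeroOfOrder (bernsteinBasis Λ a b k) (Λ.length - 1 - k) b ∧
    iteratedDeriv k (bernsteinBasis Λ a b k) a = 1 :=
  Classical.epsilon_spec hΛ.exists_isBernsteinBasis k hk

lemma bernsteinBasis_mem : bernsteinBasis Λ a b k ∈ expPolySpace Λ :=
  (hΛ.bernsteinBasis_spec hk).1

lemma contDiff_bernsteinBasis : ContDiff ℝ ∞ (bernsteinBasis Λ a b k) :=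
  (hΛ.bernsteinBasis_mem hk).1

lemma vanishesToOrder_bernsteinBasis_left : VanishesToOrder (bernsteinBasis Λ a b k) k a :=
  (hΛ.bernsteinBasis_spec hk).2.1.1

lemma hasZeroOfOrder_bernsteinBasis_right :
    HasZeroOfOrder (bernsteinBasis Λ a b k) (Λ.length - 1 - k) b :=
  (hΛ.bernsteinBasis_spec hk).2.2.1

lemma iteratedDeriv_bernsteinBasis_left : iteratedDeriv k (bernsteinBasis Λ a b k) a = 1 :=
  (hΛ.bernsteinBasis_spec hk).2.2.2

lemma eq_smul_bernsteinBasis (hf : f ∈ expPolySpace Λ) (ha : VanishesToOrder f k a)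
    (hb : VanishesToOrder f (Λ.length - 1 - k) b) :
    f = iteratedDeriv k f a • bernsteinBasis Λ a b k := by
  have hp := hΛ.bernsteinBasis_mem hk
  have hpa := hΛ.vanishesToOrder_bernsteinBasis_left hk
  have hpb : VanishesToOrder _ _ b := (hΛ.hasZeroOfOrder_bernsteinBasis_right hk).1
  set z := iteratedDeriv k f a with hz
  have hzp := (expPolySubmodule Λ).smul_mem z hp
  have hak : iteratedDeriv k (f - z • bernsteinBasis Λ a b k) a = 0 := by
    rw [iteratedDeriv_sub (contDiffAt_natCast hf.1 k a) (contDiffAt_natCast hzp.1 k a),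
      iteratedDeriv_const_smul_field, hΛ.iteratedDeriv_bernsteinBasis_left hk, ← hz, smul_eq_mul,
      mul_one, sub_self]
  exact sub_eq_zero.1 <| eq_zero_of_vanishesToOrder_endpoints hΛ
    ((expPolySubmodule Λ).sub_mem hf hzp) (k := k + 1) (l := Λ.length - 1 - k) (by omega)
    (Nat.forall_lt_succ_right.2 ⟨ha.sub hf.1 hzp.1 (hpa.smul z), hak⟩)
    (hb.sub hf.1 hzp.1 (hpb.smul z))

lemma isSelfAdjoint_bernsteinBasis : IsSelfAdjoint (bernsteinBasis Λ a b k) := by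
  have hp_star : star (bernsteinBasis Λ a b k) ∈ expPolySpace Λ := by
    rw [← expPolySpace_perm hΛ.perm_star]
    exact star_mem_expPolySpace (hΛ.bernsteinBasis_mem hk)
  have h := hΛ.eq_smul_bernsteinBasis hk hp_star
    (hΛ.vanishesToOrder_bernsteinBasis_left hk).star
    (VanishesToOrder.star (hΛ.hasZeroOfOrder_bernsteinBasis_right hk).1)
  rwa [iteratedDeriv_star, Pi.star_apply, hΛ.iteratedDeriv_bernsteinBasis_left hk, star_one,
    one_smul] at h

lemma bernsteinBasis_ne_zero : bernsteinBasis Λ a b k ≠ 0 := fun h => by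
  simpa [h] using hΛ.iteratedDeriv_bernsteinBasis_left hk

lemma bernsteinBasis_apply_ne_zero {x : ℝ} (hx : x ∈ Set.Ioo a b) : bernsteinBasis Λ a b k x ≠ 0 :=
  fun h => hΛ.bernsteinBasis_ne_zero hk <| hΛ.isChebyshev _ (hΛ.bernsteinBasis_mem hk)
    (hΛ.isSelfAdjoint_bernsteinBasis hk) <| hasZerosGE_of_endpoints_of_mem_Ioo hx
      (hΛ.vanishesToOrder_bernsteinBasis_left hk) (hΛ.hasZeroOfOrder_bernsteinBasis_right hk).1 h
      (by omega)

lemma ofReal_re_bernsteinBasis (x : ℝ) :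
    ((bernsteinBasis Λ a b k x).re : ℂ) = bernsteinBasis Λ a b k x :=
  ofReal_re_of_isSelfAdjoint (hΛ.isSelfAdjoint_bernsteinBasis hk) x

lemma bernsteinBasis_re_pos {x : ℝ} (hx : x ∈ Set.Ioo a b) :
    0 < (bernsteinBasis Λ a b k x).re := by
  have hp := hΛ.contDiff_bernsteinBasis hk
  have hlim := (tendsto_re_div_pow_of_vanishesToOrder hp
    (hΛ.vanishesToOrder_bernsteinBasis_left hk)).mono_left (nhdsGT_le_nhdsNE a)
  rw [hΛ.iteratedDeriv_bernsteinBasis_left hk, Complex.one_re] at hlim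
  obtain ⟨y, hy, hay, hyx⟩ :=
    ((hlim.eventually_const_lt (by positivity)).and (Ioo_mem_nhdsGT hx.1)).exists
  have hy_pos : 0 < (bernsteinBasis Λ a b k y).re :=
    (div_pos_iff_of_pos_right (pow_pos (sub_pos.2 hay) k)).1 hy
  by_contra! hx_nonpos
  obtain ⟨z, hz, hz_zero⟩ := intermediate_value_Icc' hyx.le
    (Complex.continuous_re.comp hp.continuous).continuousOn ⟨hx_nonpos, hy_pos.le⟩
  refine hΛ.bernsteinBasis_apply_ne_zero hk ⟨hay.trans_le hz.1, hz.2.trans_lt hx.2⟩ ?_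
  rw [← hΛ.ofReal_re_bernsteinBasis hk, show (bernsteinBasis Λ a b k z).re = 0 from hz_zero,
    Complex.ofReal_zero]

lemma bernsteinBasis_re_nonneg {x : ℝ} (hx : x ∈ Set.Icc a b) :
    0 ≤ (bernsteinBasis Λ a b k x).re := by
  have hcont := Complex.continuous_re.comp (hΛ.contDiff_bernsteinBasis hk).continuous
  rw [← closure_Ioo hΛ.lt.ne] at hx
  exact closure_minimal (fun y hy => (hΛ.bernsteinBasis_re_pos hk hy).le)
    (isClosed_Ici.preimage hcont) hx

end

end Admissible

/-- The absolute value of the first nonvanishing derivative of `p_{Λ,k}` at `b`; the sign of that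
derivative is `(-1) ^ (n - k)`, where `Λ` has `n + 1` entries. -/
noncomputable def endCoeff (a b : ℝ) (Λ : List ℂ) (k : ℕ) : ℝ :=
  (-1) ^ (Λ.length - 1 - k) * (iteratedDeriv (Λ.length - 1 - k) (bernsteinBasis Λ a b k) b).re

lemma endCoeff_perm (h : Λ.Perm Λ') (a b : ℝ) (k : ℕ) : endCoeff a b Λ k = endCoeff a b Λ' k := by
  rw [endCoeff, h.length_eq, bernsteinBasis_perm h, endCoeff]

namespace Admissible

lemma iteratedDeriv_bernsteinBasis_right (hΛ : Admissible a b Λ) (hk : k < Λ.length) :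
    iteratedDeriv (Λ.length - 1 - k) (bernsteinBasis Λ a b k) b =
      (((-1) ^ (Λ.length - 1 - k) * endCoeff a b Λ k : ℝ) : ℂ) := by
  rw [endCoeff, ← mul_assoc, ← mul_pow, neg_one_mul, neg_neg, one_pow, one_mul]
  exact (ofReal_re_of_isSelfAdjoint
    (isSelfAdjoint_iteratedDeriv (hΛ.isSelfAdjoint_bernsteinBasis hk) _) b).symm

lemma endCoeff_pos (hΛ : Admissible a b Λ) (hk : k < Λ.length) : 0 < endCoeff a b Λ k := by
  have hb := hΛ.hasZeroOfOrder_bernsteinBasis_right hk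
  have hne : endCoeff a b Λ k ≠ 0 := fun h => hb.2 <| by
    rw [hΛ.iteratedDeriv_bernsteinBasis_right hk, h, mul_zero, Complex.ofReal_zero]
  set l := Λ.length - 1 - k with hl
  have hlim := ((tendsto_re_div_pow_of_vanishesToOrder (hΛ.contDiff_bernsteinBasis hk)
    hb.1).mono_left (nhdsLT_le_nhdsNE b)).const_mul ((-1) ^ l)
  rw [← mul_div_assoc, hl, ← endCoeff, ← hl] at hlim
  have hnonneg : 0 ≤ endCoeff a b Λ k / l.factorial := by
    refine ge_of_tendsto hlim ?_
    filter_upwards [Ioo_mem_nhdsLT hΛ.lt] with x hx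
    have hpow : (x - b) ^ l = (-1) ^ l * (b - x) ^ l := by rw [← mul_pow]; ring
    rw [hpow, ← div_div, mul_div_assoc', mul_div_cancel₀ _ (by positivity)]
    exact div_nonneg (hΛ.bernsteinBasis_re_pos hk hx).le (pow_nonneg (sub_nonneg.2 hx.2.le) l)
  rw [le_div_iff₀ (by exact_mod_cast l.factorial_pos), zero_mul] at hnonneg
  exact hnonneg.lt_of_ne' hne

lemma boundaryLimit_bernsteinBasis (hΛ : Admissible a b Λ) (hΛ' : Admissible a b Λ')
    (hlen : Λ.length = Λ'.length) (hk : k < Λ.length) :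
    boundaryLimit (bernsteinBasis Λ a b k) (bernsteinBasis Λ' a b k) b =
      ((endCoeff a b Λ k / endCoeff a b Λ' k : ℝ) : ℂ) := by
  have hk' : k < Λ'.length := hlen ▸ hk
  have hb' := hΛ'.hasZeroOfOrder_bernsteinBasis_right hk'
  have hd' := hΛ'.iteratedDeriv_bernsteinBasis_right hk'
  rw [← hlen] at hb' hd'
  rw [boundaryLimit_eq (hΛ.contDiff_bernsteinBasis hk) (hΛ'.contDiff_bernsteinBasis hk')
    (hΛ.hasZeroOfOrder_bernsteinBasis_right hk).1 hb', hd',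
    hΛ.iteratedDeriv_bernsteinBasis_right hk, ← Complex.ofReal_div,
    mul_div_mul_left _ _ (pow_ne_zero _ (by norm_num))]

lemma boundaryLimit_deriv_bernsteinBasis {μ : ℂ} (hμΛ : Admissible a b (μ :: Λ))
    (hΛ : Admissible a b Λ) (hk : k < Λ.length) :
    boundaryLimit (deriv (bernsteinBasis (μ :: Λ) a b k)) (bernsteinBasis Λ a b k) b =
      ((-(endCoeff a b (μ :: Λ) k / endCoeff a b Λ k) : ℝ) : ℂ) := by
  have hk' : k < (μ :: Λ).length := Nat.lt_succ_of_lt hk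
  have hlen : (μ :: Λ).length - 1 - k = Λ.length - 1 - k + 1 := by
    rw [List.length_cons]
    omega
  have hb := (hμΛ.hasZeroOfOrder_bernsteinBasis_right hk').1
  have hd := hμΛ.iteratedDeriv_bernsteinBasis_right hk'
  rw [hlen] at hb hd
  rw [iteratedDeriv_succ', pow_succ, mul_assoc, neg_one_mul] at hd
  rw [boundaryLimit_eq (contDiff_deriv (hμΛ.contDiff_bernsteinBasis hk'))
    (hΛ.contDiff_bernsteinBasis hk) (vanishesToOrder_succ.1 hb).2
    (hΛ.hasZeroOfOrder_bernsteinBasis_right hk), hd, hΛ.iteratedDeriv_bernsteinBasis_right hk,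
    ← Complex.ofReal_div, mul_div_mul_left _ _ (pow_ne_zero _ (by norm_num)), neg_div]

end Admissible

end BasisFunctions

/-! ### Derivatives of the Bernstein basis and the expansion of exponentials -/

section ExpCoeff

variable {a b : ℝ} {Λ : List ℂ} {r : ℝ} {k : ℕ}

/-- The Bernstein basis of `E_Λ` shifted by one index and extended by zero, so that
`p_{Λ,k-1} = padBasis a b Λ k` also makes sense for `k = 0` and beyond the last index. -/
noncomputable def padBasis (a b : ℝ) (Λ : List ℂ) : ℕ → ℝ → ℂ
  | 0 => 0
  | k + 1 => if k < Λ.length then bernsteinBasis Λ a b k else 0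

lemma padBasis_succ (hk : k < Λ.length) : padBasis a b Λ (k + 1) = bernsteinBasis Λ a b k :=
  if_pos hk

lemma padBasis_length_succ : padBasis a b Λ (Λ.length + 1) = 0 := if_neg (lt_irrefl _)

lemma vanishesToOrder_zero (k : ℕ) (c : ℝ) : VanishesToOrder 0 k c := fun i _ => by simp

namespace Admissible

lemma padBasis_mem (hΛ : Admissible a b Λ) (k : ℕ) : padBasis a b Λ k ∈ expPolySpace Λ := by
  rcases k with - | k
  · exact (expPolySubmodule Λ).zero_mem
  · simp only [padBasis]
    split_ifs with hk
    · exact hΛ.bernsteinBasis_mem hk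
    · exact (expPolySubmodule Λ).zero_mem

lemma vanishesToOrder_padBasis_left (hΛ : Admissible a b Λ) (k : ℕ) :
    VanishesToOrder (padBasis a b Λ (k + 1)) k a := by
  simp only [padBasis]
  split_ifs with hk
  · exact hΛ.vanishesToOrder_bernsteinBasis_left hk
  · exact vanishesToOrder_zero _ _

lemma vanishesToOrder_padBasis_right (hΛ : Admissible a b Λ) (k : ℕ) :
    VanishesToOrder (padBasis a b Λ k) (Λ.length - k) b := by
  rcases k with - | k
  · exact vanishesToOrder_zero _ _
  · simp only [padBasis]
    split_ifs with hk
    · rw [Nat.add_comm, ← Nat.sub_sub]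
      exact (hΛ.hasZeroOfOrder_bernsteinBasis_right hk).1
    · exact vanishesToOrder_zero _ _

lemma vanishesToOrder_firstOrder_sub_padBasis (hrΛ : Admissible a b ((r : ℂ) :: Λ))
    (hk : k ≤ Λ.length) :
    VanishesToOrder (firstOrder r (bernsteinBasis ((r : ℂ) :: Λ) a b k) - padBasis a b Λ k)
      k a := by
  have hk' : k < ((r : ℂ) :: Λ).length := Nat.lt_succ_of_le hk
  have hP := hrΛ.contDiff_bernsteinBasis hk'
  have hPa := hrΛ.vanishesToOrder_bernsteinBasis_left hk'
  rcases k with - | j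
  · exact fun i hi => absurd hi i.not_lt_zero
  · have hΛ := hrΛ.of_cons
    have hQ := hΛ.contDiff_bernsteinBasis hk
    rw [padBasis_succ hk]
    refine Nat.forall_lt_succ_right.2 ⟨(hPa.firstOrder hP r).sub (contDiff_firstOrder r hP) hQ
      (hΛ.vanishesToOrder_bernsteinBasis_left hk), ?_⟩
    rw [iteratedDeriv_sub (contDiffAt_natCast (contDiff_firstOrder r hP) j a)
      (contDiffAt_natCast hQ j a), iteratedDeriv_firstOrder r hP, hPa j j.lt_succ_self,
      hrΛ.iteratedDeriv_bernsteinBasis_left hk', hΛ.iteratedDeriv_bernsteinBasis_left hk, mul_zero,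
      sub_zero, sub_self]

lemma vanishesToOrder_firstOrder_add_padBasis (hrΛ : Admissible a b ((r : ℂ) :: Λ))
    (hk : k ≤ Λ.length) :
    VanishesToOrder (firstOrder r (bernsteinBasis ((r : ℂ) :: Λ) a b k) +
      ((endCoeff a b ((r : ℂ) :: Λ) k / endCoeff a b Λ k : ℝ) : ℂ) • padBasis a b Λ (k + 1))
      (Λ.length - k) b := by
  rcases hk.eq_or_lt with rfl | hk
  · exact fun i hi => absurd hi (by omega)
  have hΛ := hrΛ.of_cons
  have hk' : k < ((r : ℂ) :: Λ).length := Nat.lt_succ_of_lt hk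
  have hlen : ((r : ℂ) :: Λ).length - 1 - k = Λ.length - 1 - k + 1 := by
    rw [List.length_cons]
    omega
  have hP := hrΛ.contDiff_bernsteinBasis hk'
  have hQ := hΛ.contDiff_bernsteinBasis hk
  have hPb := (hrΛ.hasZeroOfOrder_bernsteinBasis_right hk').1
  have hPd := hrΛ.iteratedDeriv_bernsteinBasis_right hk'
  have hQb : VanishesToOrder _ _ b := (hΛ.hasZeroOfOrder_bernsteinBasis_right hk).1
  rw [hlen] at hPb hPd
  rw [padBasis_succ hk, show Λ.length - k = Λ.length - 1 - k + 1 by omega]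
  set κ : ℂ := ((endCoeff a b ((r : ℂ) :: Λ) k / endCoeff a b Λ k : ℝ) : ℂ) with hκ
  have hκQ : ContDiff ℝ ∞ (κ • bernsteinBasis Λ a b k) := hQ.const_smul κ
  refine Nat.forall_lt_succ_right.2 ⟨VanishesToOrder.add (contDiff_firstOrder r hP) hκQ
    (VanishesToOrder.firstOrder hP hPb r) (hQb.smul κ), ?_⟩
  rw [iteratedDeriv_add (contDiffAt_natCast (contDiff_firstOrder r hP) _ b)
    (contDiffAt_natCast hκQ _ b), iteratedDeriv_const_smul_field,
    iteratedDeriv_firstOrder r hP, hPb _ (Nat.lt_succ_self _), hPd,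
    hΛ.iteratedDeriv_bernsteinBasis_right hk, hκ, smul_eq_mul, mul_zero, sub_zero]
  have hne : (endCoeff a b Λ k : ℂ) ≠ 0 := Complex.ofReal_ne_zero.2 (hΛ.endCoeff_pos hk).ne'
  push_cast
  field_simp
  ring

theorem firstOrder_bernsteinBasis (hrΛ : Admissible a b ((r : ℂ) :: Λ)) (hk : k ≤ Λ.length) :
    firstOrder r (bernsteinBasis ((r : ℂ) :: Λ) a b k) = padBasis a b Λ k -
      ((endCoeff a b ((r : ℂ) :: Λ) k / endCoeff a b Λ k : ℝ) : ℂ) • padBasis a b Λ (k + 1) := by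
  have hΛ := hrΛ.of_cons
  have ha := hrΛ.vanishesToOrder_firstOrder_sub_padBasis hk
  have hb := hrΛ.vanishesToOrder_firstOrder_add_padBasis hk
  set p := firstOrder r (bernsteinBasis ((r : ℂ) :: Λ) a b k)
  set κ : ℂ := ((endCoeff a b ((r : ℂ) :: Λ) k / endCoeff a b Λ k : ℝ) : ℂ)
  have hp : p ∈ expPolySubmodule Λ :=
    (mem_expPolySpace_cons.1 (hrΛ.bernsteinBasis_mem (Nat.lt_succ_of_le hk))).2
  have hq : padBasis a b Λ k ∈ expPolySubmodule Λ := hΛ.padBasis_mem k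
  have hq' : κ • padBasis a b Λ (k + 1) ∈ expPolySubmodule Λ :=
    Submodule.smul_mem _ κ (hΛ.padBasis_mem (k + 1))
  have hpq := Submodule.sub_mem _ hp hq
  have ha' : VanishesToOrder (p - padBasis a b Λ k + κ • padBasis a b Λ (k + 1)) k a :=
    ha.add hpq.1 hq'.1 ((hΛ.vanishesToOrder_padBasis_left k).smul κ)
  have hb' : VanishesToOrder (p + κ • padBasis a b Λ (k + 1) - padBasis a b Λ k) (Λ.length - k) b :=
    hb.sub (Submodule.add_mem _ hp hq').1 hq.1 (hΛ.vanishesToOrder_padBasis_right k)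
  rw [add_sub_right_comm] at hb'
  have h := eq_zero_of_vanishesToOrder_endpoints hΛ (Submodule.add_mem _ hpq hq') (by omega) ha' hb'
  rwa [sub_add, sub_eq_zero] at h

end Admissible

/-- The coefficients of `exp (μ (x - a))` in the Bernstein basis of `E_{(μ, Λ)}`. -/
noncomputable def expCoeff (a b : ℝ) (μ : ℂ) (Λ : List ℂ) (k : ℕ) : ℝ :=
  ∏ l ∈ Finset.range k, endCoeff a b (μ :: Λ) l / endCoeff a b Λ l

lemma expCoeff_zero (a b : ℝ) (μ : ℂ) (Λ : List ℂ) : expCoeff a b μ Λ 0 = 1 := rfl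

lemma expCoeff_succ (a b : ℝ) (μ : ℂ) (Λ : List ℂ) (k : ℕ) : expCoeff a b μ Λ (k + 1) =
    expCoeff a b μ Λ k * (endCoeff a b (μ :: Λ) k / endCoeff a b Λ k) :=
  Finset.prod_range_succ _ _

namespace Admissible

lemma expCoeff_pos (hrΛ : Admissible a b ((r : ℂ) :: Λ)) (hk : k ≤ Λ.length) :
    0 < expCoeff a b r Λ k :=
  Finset.prod_pos fun _ hl =>
    have hl := (Finset.mem_range.1 hl).trans_le hk
    div_pos (hrΛ.endCoeff_pos (Nat.lt_succ_of_lt hl)) (hrΛ.of_cons.endCoeff_pos hl)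

lemma sum_expCoeff_mul_firstOrder_bernsteinBasis (hrΛ : Admissible a b ((r : ℂ) :: Λ)) :
    ∑ k ∈ Finset.range (Λ.length + 1), (expCoeff a b r Λ k : ℂ) •
      firstOrder r (bernsteinBasis ((r : ℂ) :: Λ) a b k) = 0 := by
  have hstep : ∀ k ∈ Finset.range (Λ.length + 1), (expCoeff a b r Λ k : ℂ) •
      firstOrder r (bernsteinBasis ((r : ℂ) :: Λ) a b k) =
      (expCoeff a b r Λ k : ℂ) • padBasis a b Λ k -
        (expCoeff a b r Λ (k + 1) : ℂ) • padBasis a b Λ (k + 1) := fun k hk => by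
    rw [hrΛ.firstOrder_bernsteinBasis (Finset.mem_range_succ_iff.1 hk), expCoeff_succ, smul_sub,
      smul_smul, Complex.ofReal_mul]
  rw [Finset.sum_congr rfl hstep, Finset.sum_range_sub', padBasis_length_succ, padBasis, smul_zero,
    smul_zero, sub_zero]

theorem shiftedExp_eq_sum_bernsteinBasis (hrΛ : Admissible a b ((r : ℂ) :: Λ)) :
    shiftedExp r a = ∑ k ∈ Finset.range (Λ.length + 1),
      (expCoeff a b r Λ k : ℂ) • bernsteinBasis ((r : ℂ) :: Λ) a b k := by
  set p := bernsteinBasis ((r : ℂ) :: Λ) a b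
  have hp : ∀ k ∈ Finset.range (Λ.length + 1), p k ∈ expPolySpace ((r : ℂ) :: Λ) := fun k hk =>
    hrΛ.bernsteinBasis_mem (Finset.mem_range.1 hk)
  set F := ∑ k ∈ Finset.range (Λ.length + 1), (expCoeff a b r Λ k : ℂ) • p k with hF
  have hF_mem : F ∈ expPolySubmodule ((r : ℂ) :: Λ) :=
    Submodule.sum_mem _ fun k hk => Submodule.smul_mem _ _ (hp k hk)
  have hF_firstOrder : firstOrder r F = 0 := by
    rw [← hrΛ.sum_expCoeff_mul_firstOrder_bernsteinBasis,
      firstOrder_sum_smul _ _ _ fun k hk => (hp k hk).1]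
  have hF_left : F a = 1 := by
    have hp_zero : p 0 a = 1 := by
      simpa using hrΛ.iteratedDeriv_bernsteinBasis_left (k := 0) (Nat.succ_pos _)
    have hp_succ : ∀ k ∈ Finset.range Λ.length, (expCoeff a b r Λ (k + 1) : ℂ) * p (k + 1) a = 0 :=
      fun k hk => by
        have hpa : p (k + 1) a = 0 := (hrΛ.vanishesToOrder_bernsteinBasis_left
          (Nat.succ_lt_succ (Finset.mem_range.1 hk))).apply_eq_zero k.succ_pos
        rw [hpa, mul_zero]
    simp only [hF, Finset.sum_apply, Pi.smul_apply, smul_eq_mul]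
    rw [Finset.sum_range_succ', Finset.sum_eq_zero hp_succ, hp_zero, expCoeff_zero]
    simp
  rw [eq_smul_shiftedExp hF_mem.1 hF_firstOrder a, hF_left, one_smul]

end Admissible

end ExpCoeff

/-! ### The nodes and the coefficients of the Bernstein operator -/

section Nodes

variable {a b lam0 lam1 : ℝ} {R : List ℂ} {k : ℕ}

lemma iteratedDeriv_padBasis_succ (hR : Admissible a b R) (k : ℕ) :
    iteratedDeriv k (padBasis a b R (k + 1)) a = if k < R.length then 1 else 0 := by
  simp only [padBasis]
  split_ifs with hk
  · exact hR.iteratedDeriv_bernsteinBasis_left hk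
  · simp

namespace Admissible

lemma iteratedDeriv_succ_bernsteinBasis_left {r : ℝ} (hrR : Admissible a b ((r : ℂ) :: R))
    (hk : k ≤ R.length) :
    iteratedDeriv (k + 1) (bernsteinBasis ((r : ℂ) :: R) a b k) a =
      r + iteratedDeriv k (padBasis a b R k) a -
        (endCoeff a b ((r : ℂ) :: R) k / endCoeff a b R k : ℝ) *
          (if k < R.length then 1 else 0) := by
  have hR := hrR.of_cons
  have hk' : k < ((r : ℂ) :: R).length := Nat.lt_succ_of_le hk
  set κ : ℂ := ((endCoeff a b ((r : ℂ) :: R) k / endCoeff a b R k : ℝ) : ℂ) with hκ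
  have hpad : ContDiff ℝ ∞ (κ • padBasis a b R (k + 1)) := (hR.padBasis_mem (k + 1)).1.const_smul κ
  have h := iteratedDeriv_firstOrder r (hrR.contDiff_bernsteinBasis hk') k a
  rw [hrR.firstOrder_bernsteinBasis hk, ← hκ,
    iteratedDeriv_sub (contDiffAt_natCast (hR.padBasis_mem k).1 k a) (contDiffAt_natCast hpad k a),
    iteratedDeriv_const_smul_field, iteratedDeriv_padBasis_succ hR, smul_eq_mul,
    hrR.iteratedDeriv_bernsteinBasis_left hk'] at h
  linear_combination -h

lemma bernsteinBasis_sub_bernsteinBasis (hR : Admissible a b R) (lam0 lam1 : ℝ)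
    (hk : k ≤ R.length) :
    bernsteinBasis ((lam0 : ℂ) :: R) a b k - bernsteinBasis ((lam1 : ℂ) :: R) a b k =
      iteratedDeriv (k + 1)
          (bernsteinBasis ((lam0 : ℂ) :: R) a b k - bernsteinBasis ((lam1 : ℂ) :: R) a b k) a •
        bernsteinBasis ((lam0 : ℂ) :: (lam1 : ℂ) :: R) a b (k + 1) := by
  have h0 := hR.cons lam0
  have h1 := hR.cons lam1
  have hk0 : k < ((lam0 : ℂ) :: R).length := Nat.lt_succ_of_le hk
  have hk1 : k < ((lam1 : ℂ) :: R).length := Nat.lt_succ_of_le hk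
  have hu := h0.contDiff_bernsteinBasis hk0
  have hv := h1.contDiff_bernsteinBasis hk1
  have hu_mem : bernsteinBasis ((lam0 : ℂ) :: R) a b k ∈
      expPolySubmodule ((lam0 : ℂ) :: (lam1 : ℂ) :: R) := by
    have h := mem_expPolySpace_cons_of_mem lam1 (h0.bernsteinBasis_mem hk0)
    rwa [expPolySpace_perm (List.Perm.swap (lam0 : ℂ) lam1 R)] at h
  have hv_mem : bernsteinBasis ((lam1 : ℂ) :: R) a b k ∈
      expPolySubmodule ((lam0 : ℂ) :: (lam1 : ℂ) :: R) :=
    mem_expPolySpace_cons_of_mem _ (h1.bernsteinBasis_mem hk1)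
  refine (h1.cons lam0).eq_smul_bernsteinBasis (Nat.succ_lt_succ hk1)
    (Submodule.sub_mem _ hu_mem hv_mem) (Nat.forall_lt_succ_right.2 ⟨?_, ?_⟩) ?_
  · exact (h0.vanishesToOrder_bernsteinBasis_left hk0).sub hu hv
      (h1.vanishesToOrder_bernsteinBasis_left hk1)
  · rw [iteratedDeriv_sub (contDiffAt_natCast hu k a) (contDiffAt_natCast hv k a),
      h0.iteratedDeriv_bernsteinBasis_left hk0, h1.iteratedDeriv_bernsteinBasis_left hk1, sub_self]
  · rw [show ((lam0 : ℂ) :: (lam1 : ℂ) :: R).length - 1 - (k + 1) = R.length - k from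
      Nat.add_sub_add_right _ _ _]
    exact VanishesToOrder.sub hu hv (h0.hasZeroOfOrder_bernsteinBasis_right hk0).1
      (h1.hasZeroOfOrder_bernsteinBasis_right hk1).1

lemma endCoeff_sub_endCoeff (hR : Admissible a b R) (lam0 lam1 : ℝ) (hk : k ≤ R.length) :
    endCoeff a b ((lam0 : ℂ) :: R) k - endCoeff a b ((lam1 : ℂ) :: R) k =
      (lam0 - lam1 - (endCoeff a b ((lam0 : ℂ) :: R) k - endCoeff a b ((lam1 : ℂ) :: R) k) /
        endCoeff a b R k * (if k < R.length then 1 else 0)) *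
        endCoeff a b ((lam0 : ℂ) :: (lam1 : ℂ) :: R) (k + 1) := by
  have h0 := hR.cons lam0
  have h1 := hR.cons lam1
  have hk0 : k < ((lam0 : ℂ) :: R).length := Nat.lt_succ_of_le hk
  have hk1 : k < ((lam1 : ℂ) :: R).length := Nat.lt_succ_of_le hk
  have hu := h0.contDiff_bernsteinBasis hk0
  have hv := h1.contDiff_bernsteinBasis hk1
  have hu_right := h0.iteratedDeriv_bernsteinBasis_right hk0
  have hv_right := h1.iteratedDeriv_bernsteinBasis_right hk1
  have hP_right := (h1.cons lam0).iteratedDeriv_bernsteinBasis_right (Nat.succ_lt_succ hk1)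
  rw [show ((lam0 : ℂ) :: (lam1 : ℂ) :: R).length - 1 - (k + 1) = R.length - k from
    Nat.add_sub_add_right _ _ _] at hP_right
  rw [List.length_cons, Nat.add_sub_cancel] at hu_right hv_right
  have h := congrArg (iteratedDeriv (R.length - k) · b)
    (hR.bernsteinBasis_sub_bernsteinBasis lam0 lam1 hk)
  beta_reduce at h
  rw [iteratedDeriv_sub (contDiffAt_natCast hu _ b) (contDiffAt_natCast hv _ b),
    iteratedDeriv_const_smul_field,
    iteratedDeriv_sub (contDiffAt_natCast hu _ a) (contDiffAt_natCast hv _ a),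
    h0.iteratedDeriv_succ_bernsteinBasis_left hk, h1.iteratedDeriv_succ_bernsteinBasis_left hk,
    hu_right, hv_right, hP_right, Complex.ofReal_mul, Complex.ofReal_mul, Complex.ofReal_mul,
    ← mul_sub, smul_eq_mul, mul_left_comm] at h
  have h := mul_left_cancel₀ (by simp) h
  apply Complex.ofReal_injective
  push_cast [apply_ite Complex.ofReal] at h ⊢
  linear_combination h

theorem endCoeff_lt_endCoeff (hR : Admissible a b R) (h : lam1 < lam0) (hk : k ≤ R.length) :
    endCoeff a b ((lam1 : ℂ) :: R) k < endCoeff a b ((lam0 : ℂ) :: R) k := by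
  have hP : 0 < endCoeff a b ((lam0 : ℂ) :: (lam1 : ℂ) :: R) (k + 1) :=
    ((hR.cons lam1).cons lam0).endCoeff_pos (Nat.succ_lt_succ (Nat.lt_succ_of_le hk))
  have hsub := hR.endCoeff_sub_endCoeff lam0 lam1 hk
  by_contra! hle
  have hsub_nonpos := sub_nonpos.2 hle
  refine hsub_nonpos.not_gt (hsub ▸ mul_pos (sub_pos.2 ?_) hP)
  refine lt_of_le_of_lt ?_ (sub_pos.2 h)
  split_ifs with hk
  · rw [mul_one]
    exact div_nonpos_of_nonpos_of_nonneg hsub_nonpos (hR.endCoeff_pos hk).le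
  · rw [mul_zero]

lemma bernsteinNode_succ (hR : Admissible a b R) (lam0 lam1 : ℝ) (hk : k ≤ R.length) :
    bernsteinNode a b lam0 lam1 R (k + 1) = bernsteinNode a b lam0 lam1 R k +
      Real.log (endCoeff a b ((lam0 : ℂ) :: R) k / endCoeff a b ((lam1 : ℂ) :: R) k) /
        (lam0 - lam1) := by
  rw [bernsteinNode, (hR.cons lam0).boundaryLimit_bernsteinBasis (hR.cons lam1) (by simp)
    (Nat.lt_succ_of_le hk), Complex.ofReal_re]

lemma bernsteinNode_lt_succ (hR : Admissible a b R) (h01 : lam0 ≠ lam1) (hk : k ≤ R.length) :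
    bernsteinNode a b lam0 lam1 R k < bernsteinNode a b lam0 lam1 R (k + 1) := by
  have hD (r : ℝ) : 0 < endCoeff a b ((r : ℂ) :: R) k :=
    (hR.cons r).endCoeff_pos (Nat.lt_succ_of_le hk)
  rw [hR.bernsteinNode_succ lam0 lam1 hk]
  refine lt_add_of_pos_right _ ?_
  rcases h01.lt_or_gt with h | h
  · exact div_pos_of_neg_of_neg (Real.log_neg (div_pos (hD _) (hD _))
      ((div_lt_one (hD _)).2 (hR.endCoeff_lt_endCoeff h hk))) (sub_neg.2 h)
  · exact div_pos (Real.log_pos ((one_lt_div (hD _)).2 (hR.endCoeff_lt_endCoeff h hk)))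
      (sub_pos.2 h)

lemma exp_mul_bernsteinNode_succ_sub (hR : Admissible a b R) (h01 : lam0 ≠ lam1)
    (hk : k ≤ R.length) :
    Real.exp ((lam0 - lam1) *
      (bernsteinNode a b lam0 lam1 R (k + 1) - bernsteinNode a b lam0 lam1 R k)) =
      endCoeff a b ((lam0 : ℂ) :: R) k / endCoeff a b ((lam1 : ℂ) :: R) k := by
  have hD (r : ℝ) : 0 < endCoeff a b ((r : ℂ) :: R) k :=
    (hR.cons r).endCoeff_pos (Nat.lt_succ_of_le hk)
  rw [hR.bernsteinNode_succ lam0 lam1 hk, add_sub_cancel_left,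
    mul_div_cancel₀ _ (sub_ne_zero.2 h01), Real.exp_log (div_pos (hD _) (hD _))]

/-- The nodes are chosen so that the operator reproduces both `exp (λ₀ x)` and `exp (λ₁ x)`. -/
theorem expCoeff_eq_mul_exp (hR : Admissible a b R) (h01 : lam0 ≠ lam1) (hk : k ≤ R.length + 1) :
    expCoeff a b lam0 ((lam1 : ℂ) :: R) k = expCoeff a b lam1 ((lam0 : ℂ) :: R) k *
      Real.exp ((lam0 - lam1) * (bernsteinNode a b lam0 lam1 R k - a)) := by
  induction k with
  | zero => simp [expCoeff, bernsteinNode]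
  | succ k ih =>
    have hD (r : ℝ) : endCoeff a b ((r : ℂ) :: R) k ≠ 0 :=
      ((hR.cons r).endCoeff_pos hk).ne'
    have hexp : Real.exp ((lam0 - lam1) * (bernsteinNode a b lam0 lam1 R (k + 1) - a)) =
        Real.exp ((lam0 - lam1) * (bernsteinNode a b lam0 lam1 R k - a)) *
          (endCoeff a b ((lam0 : ℂ) :: R) k / endCoeff a b ((lam1 : ℂ) :: R) k) := by
      rw [← hR.exp_mul_bernsteinNode_succ_sub h01 (Nat.le_of_succ_le_succ hk), ← Real.exp_add]
      ring_nf
    have hD0 := hD lam0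
    have hD1 := hD lam1
    rw [expCoeff_succ, expCoeff_succ, ih (Nat.le_of_succ_le hk), hexp,
      endCoeff_perm (List.Perm.swap (lam0 : ℂ) lam1 R)]
    field_simp

lemma shiftedExp_right (h : Admissible a b ((lam0 : ℂ) :: R)) :
    shiftedExp lam0 a b = expCoeff a b lam0 R R.length *
      bernsteinBasis ((lam0 : ℂ) :: R) a b R.length b := by
  rw [h.shiftedExp_eq_sum_bernsteinBasis, Finset.sum_range_succ, Pi.add_apply, Finset.sum_apply,
    Finset.sum_eq_zero, zero_add, Pi.smul_apply, smul_eq_mul]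
  intro k hk
  have hk := Finset.mem_range.1 hk
  have hb := (h.hasZeroOfOrder_bernsteinBasis_right (Nat.lt_succ_of_lt hk)).1
  rw [Pi.smul_apply, VanishesToOrder.apply_eq_zero hb (Nat.sub_pos_of_lt hk), smul_zero]

lemma bernsteinNode_last (hR : Admissible a b R) (h01 : lam0 ≠ lam1) :
    bernsteinNode a b lam0 lam1 R (R.length + 1) = b := by
  have h0 := ((hR.cons lam1).cons lam0).shiftedExp_right
  have h1 := ((hR.cons lam0).cons lam1).shiftedExp_right
  rw [List.length_cons, hR.expCoeff_eq_mul_exp h01 le_rfl,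
    bernsteinBasis_perm (List.Perm.swap (lam1 : ℂ) lam0 R), shiftedExp_ofReal] at h0
  rw [List.length_cons, shiftedExp_ofReal] at h1
  set t := bernsteinNode a b lam0 lam1 R (R.length + 1)
  have hexp : Real.exp (lam0 * (b - a)) =
      Real.exp (lam1 * (b - a)) * Real.exp ((lam0 - lam1) * (t - a)) := by
    apply Complex.ofReal_injective
    rw [h0, Complex.ofReal_mul, Complex.ofReal_mul, h1, mul_right_comm]
  rw [← Real.exp_add, Real.exp_eq_exp] at hexp
  have hmul : (lam0 - lam1) * (t - b) = 0 := by linear_combination -hexp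
  exact sub_eq_zero.1 ((mul_eq_zero.1 hmul).resolve_left (sub_ne_zero.2 h01))

lemma monotoneOn_bernsteinNode (hR : Admissible a b R) (h01 : lam0 ≠ lam1) :
    MonotoneOn (bernsteinNode a b lam0 lam1 R) (Set.Iic (R.length + 1)) :=
  monotoneOn_of_le_add_one Set.ordConnected_Iic fun _ _ _ hk =>
    (hR.bernsteinNode_lt_succ h01 (Nat.le_of_succ_le_succ hk)).le

lemma bernsteinNode_mem_Icc (hR : Admissible a b R) (h01 : lam0 ≠ lam1) (hk : k ≤ R.length + 1) :
    bernsteinNode a b lam0 lam1 R k ∈ Set.Icc a b := by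
  have hmono := hR.monotoneOn_bernsteinNode h01
  have hlast := hmono hk (Set.mem_Iic.2 le_rfl) hk
  rw [hR.bernsteinNode_last h01] at hlast
  exact ⟨hmono (Nat.zero_le _) hk (Nat.zero_le k), hlast⟩

lemma bernsteinCoeff_eq (hR : Admissible a b R) (lam0 lam1 : ℝ) (hk : k ≤ R.length + 1) :
    bernsteinCoeff a b lam0 lam1 R k =
      ((Real.exp (-lam0 * (bernsteinNode a b lam0 lam1 R k - a)) *
        expCoeff a b lam0 ((lam1 : ℂ) :: R) k : ℝ) : ℂ) := by
  have hlim : ∀ l ∈ Finset.range k,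
      boundaryLimit (deriv (bernsteinBasis ((lam0 : ℂ) :: (lam1 : ℂ) :: R) a b l))
        (bernsteinBasis ((lam1 : ℂ) :: R) a b l) b =
      ((-(endCoeff a b ((lam0 : ℂ) :: (lam1 : ℂ) :: R) l / endCoeff a b ((lam1 : ℂ) :: R) l) : ℝ) :
        ℂ) := fun l hl =>
    ((hR.cons lam1).cons lam0).boundaryLimit_deriv_bernsteinBasis (hR.cons lam1)
      ((Finset.mem_range.1 hl).trans_le hk)
  rw [bernsteinCoeff, Finset.prod_congr rfl hlim, ← Complex.ofReal_prod, Finset.prod_neg,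
    Finset.card_range, ← expCoeff]
  push_cast
  rw [mul_assoc, ← mul_assoc ((-1 : ℂ) ^ k), ← mul_pow, neg_one_mul, neg_neg, one_pow, one_mul]

end Admissible

end Nodes

/-! ### A Korovkin theorem for three exponentials -/

section Korovkin

lemma exists_le_add_mul_of_isCompact {X : Type*} [TopologicalSpace X] [T2Space X] {S : Set X}
    {F G : X → ℝ} (hS : IsCompact S) (hF : ContinuousOn F S) (hG : ContinuousOn G S)
    (hG_nonneg : ∀ x ∈ S, 0 ≤ G x) (hFG : ∀ x ∈ S, G x = 0 → F x ≤ 0) {ε : ℝ} (hε : 0 < ε) :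
    ∃ C ≥ 0, ∀ x ∈ S, F x ≤ ε + C * G x := by
  have hS' : IsCompact (S ∩ F ⁻¹' Set.Ici ε) :=
    hS.of_isClosed_subset (hF.preimage_isClosed_of_isClosed hS.isClosed isClosed_Ici)
      Set.inter_subset_left
  have hG_pos : ∀ x ∈ S ∩ F ⁻¹' Set.Ici ε, 0 < G x := fun x hx =>
    (hG_nonneg x hx.1).lt_of_ne' fun h => (hε.trans_le hx.2).not_ge (hFG x hx.1 h)
  obtain ⟨C, hC⟩ := hS'.bddAbove_image <| (hF.mono Set.inter_subset_left).div
    (hG.mono Set.inter_subset_left) fun x hx => (hG_pos x hx).ne'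
  refine ⟨max C 0, le_max_right _ _, fun x hx => ?_⟩
  have hCG : 0 ≤ max C 0 * G x := mul_nonneg (le_max_right _ _) (hG_nonneg x hx)
  rcases le_or_gt ε (F x) with h | h
  · have hquot : F x / G x ≤ max C 0 :=
      (hC (Set.mem_image_of_mem _ ⟨hx, h⟩)).trans (le_max_left _ _)
    exact ((div_le_iff₀ (hG_pos x ⟨hx, h⟩)).1 hquot).trans (le_add_of_nonneg_left hε.le)
  · exact h.le.trans (le_add_of_nonneg_right hCG)

/-- The combination of `1`, `exp (m₁ z)` and `exp (m₂ z)` with a double zero at `0`, normalized to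
be positive elsewhere; it measures the distance of `z` from `0` in the Korovkin argument. -/
noncomputable def expPeak (m₁ m₂ z : ℝ) : ℝ :=
  ((Real.exp (m₂ * z) - 1) / m₂ - (Real.exp (m₁ * z) - 1) / m₁) / (m₂ - m₁)

variable {m₁ m₂ : ℝ}

lemma expPeak_zero (m₁ m₂ : ℝ) : expPeak m₁ m₂ 0 = 0 := by simp [expPeak]

lemma expPeak_pos (h₁ : m₁ ≠ 0) (h₂ : m₂ ≠ 0) (h₁₂ : m₁ ≠ m₂) {z : ℝ} (hz : z ≠ 0) :
    0 < expPeak m₁ m₂ z := by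
  have hsecant {u v : ℝ} (hu : u ≠ 0) (hv : v ≠ 0) (h : u < v) :
      (Real.exp u - 1) / u < (Real.exp v - 1) / v := by
    simpa only [Real.exp_zero, sub_zero] using
      strictConvexOn_exp.secant_strict_mono (Set.mem_univ 0) (Set.mem_univ u) (Set.mem_univ v) hu
        hv h
  have hslope : 0 < ((Real.exp (m₂ * z) - 1) / (m₂ * z) - (Real.exp (m₁ * z) - 1) / (m₁ * z)) /
      (m₂ * z - m₁ * z) := by
    have hu := mul_ne_zero h₁ hz
    have hv := mul_ne_zero h₂ hz
    rcases (mul_left_injective₀ hz).ne h₁₂ |>.lt_or_gt with h | h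
    · exact div_pos (sub_pos.2 (hsecant hu hv h)) (sub_pos.2 h)
    · exact div_pos_of_neg_of_neg (sub_neg.2 (hsecant hv hu h)) (sub_neg.2 h)
  have heq : expPeak m₁ m₂ z = z ^ 2 * (((Real.exp (m₂ * z) - 1) / (m₂ * z) -
      (Real.exp (m₁ * z) - 1) / (m₁ * z)) / (m₂ * z - m₁ * z)) := by
    have := sub_ne_zero.2 h₁₂.symm
    rw [expPeak, ← sub_mul]
    field_simp
  rw [heq]
  positivity

lemma continuous_expPeak (m₁ m₂ : ℝ) : Continuous (expPeak m₁ m₂) := by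
  unfold expPeak
  fun_prop

variable {E : Type*} [NormedAddCommGroup E] [NormedSpace ℝ E] {lam0 lam1 lam2 : ℝ} {K : Set ℝ}

lemma exists_norm_exp_smul_sub_le (hK : IsCompact K) (h01 : lam0 ≠ lam1) (h02 : lam0 ≠ lam2)
    (h12 : lam1 ≠ lam2) {f : ℝ → E} (hf : ContinuousOn f K) {ε : ℝ} (hε : 0 < ε) :
    ∃ C ≥ 0, ∀ x ∈ K, ∀ y ∈ K, ‖f y - Real.exp (lam0 * (y - x)) • f x‖ ≤
      Real.exp (lam0 * (y - x)) * (ε + C * expPeak (lam1 - lam0) (lam2 - lam0) (y - x)) := by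
  set Q := expPeak (lam1 - lam0) (lam2 - lam0)
  have hQ_pos {z : ℝ} (hz : z ≠ 0) : 0 < Q z :=
    expPeak_pos (sub_ne_zero.2 h01.symm) (sub_ne_zero.2 h02.symm) (sub_left_injective.ne h12) hz
  have hF : ContinuousOn (fun p : ℝ × ℝ => ‖Real.exp (-(lam0 * (p.2 - p.1))) • f p.2 - f p.1‖)
      (K ×ˢ K) := by
    have hf₁ := hf.comp (continuousOn_fst (s := K ×ˢ K)) fun _ h => h.1
    have hf₂ := hf.comp (continuousOn_snd (s := K ×ˢ K)) fun _ h => h.2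
    exact ((Continuous.continuousOn (by fun_prop)).smul hf₂).sub hf₁ |>.norm
  have hG : Continuous fun p : ℝ × ℝ => Q (p.2 - p.1) :=
    (continuous_expPeak _ _).comp (continuous_snd.sub continuous_fst)
  have hG_nonneg (p : ℝ × ℝ) : 0 ≤ Q (p.2 - p.1) := by
    rcases eq_or_ne (p.2 - p.1) 0 with h | h
    · exact ((congrArg Q h).trans (expPeak_zero _ _)).ge
    · exact (hQ_pos h).le
  have hFG (p : ℝ × ℝ) (hp : Q (p.2 - p.1) = 0) :
      ‖Real.exp (-(lam0 * (p.2 - p.1))) • f p.2 - f p.1‖ ≤ 0 := by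
    have h : p.2 - p.1 = 0 := by_contra fun h => (hQ_pos h).ne' hp
    rw [h, mul_zero, neg_zero, Real.exp_zero, one_smul, sub_eq_zero.1 h, sub_self, norm_zero]
  obtain ⟨C, hC, hbound⟩ := exists_le_add_mul_of_isCompact (hK.prod hK) hF hG.continuousOn
    (fun p _ => hG_nonneg p) (fun p _ => hFG p) hε
  refine ⟨C, hC, fun x hx y hy => ?_⟩
  have hfactor : f y - Real.exp (lam0 * (y - x)) • f x =
      Real.exp (lam0 * (y - x)) • (Real.exp (-(lam0 * (y - x))) • f y - f x) := by
    rw [smul_sub, smul_smul, ← Real.exp_add, add_neg_cancel, Real.exp_zero, one_smul]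
  rw [hfactor, norm_smul, Real.norm_of_nonneg (Real.exp_pos _).le]
  exact mul_le_mul_of_nonneg_left (hbound (x, y) ⟨hx, hy⟩) (Real.exp_pos _).le

lemma exp_mul_expPeak (lam0 lam1 lam2 z : ℝ) :
    Real.exp (lam0 * z) * expPeak (lam1 - lam0) (lam2 - lam0) z =
      ((Real.exp (lam2 * z) - Real.exp (lam0 * z)) / (lam2 - lam0) -
        (Real.exp (lam1 * z) - Real.exp (lam0 * z)) / (lam1 - lam0)) / (lam2 - lam1) := by
  rw [expPeak, sub_sub_sub_cancel_right, mul_div_assoc', mul_sub, mul_div_assoc', mul_div_assoc',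
    mul_sub, mul_sub, mul_one, ← Real.exp_add, ← Real.exp_add, ← add_mul, ← add_mul,
    add_sub_cancel, add_sub_cancel]

lemma norm_sum_smul_sub_le {κ : Type*} {s : Finset κ} {w c p : κ → ℝ} {v : κ → E} {u : E} {ε C : ℝ}
    (hw : ∀ k ∈ s, 0 ≤ w k) (hv : ∀ k ∈ s, ‖v k - c k • u‖ ≤ c k * (ε + C * p k)) :
    ‖∑ k ∈ s, w k • v k - u‖ ≤ ε * ∑ k ∈ s, w k * c k + C * ∑ k ∈ s, w k * (c k * p k) +
      |∑ k ∈ s, w k * c k - 1| * ‖u‖ := by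
  have hsplit : ∑ k ∈ s, w k • v k - u =
      ∑ k ∈ s, w k • (v k - c k • u) + (∑ k ∈ s, w k * c k - 1) • u := by
    simp only [smul_sub, smul_smul, Finset.sum_sub_distrib, ← Finset.sum_smul, sub_smul, one_smul]
    abel
  rw [hsplit, ← Real.norm_eq_abs, ← norm_smul]
  refine norm_add_le_of_le ?_ le_rfl
  calc ‖∑ k ∈ s, w k • (v k - c k • u)‖
      ≤ ∑ k ∈ s, w k * (c k * (ε + C * p k)) := norm_sum_le_of_le s fun k hk => by
        rw [norm_smul, Real.norm_of_nonneg (hw k hk)]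
        exact mul_le_mul_of_nonneg_left (hv k hk) (hw k hk)
    _ = ε * ∑ k ∈ s, w k * c k + C * ∑ k ∈ s, w k * (c k * p k) := by
        rw [Finset.mul_sum, Finset.mul_sum, ← Finset.sum_add_distrib]
        exact Finset.sum_congr rfl fun k _ => by ring

section Net

variable {ι κ : Type*} {l : Filter ι} {s : ι → Finset κ} {w : ι → κ → ℝ → ℝ} {t : ι → κ → ℝ}
  (h0 : TendstoUniformlyOn
    (fun i x => ∑ k ∈ s i, w i k x * Real.exp (lam0 * (t i k - x))) 1 l K)
  (h1 : TendstoUniformlyOn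
    (fun i x => ∑ k ∈ s i, w i k x * Real.exp (lam1 * (t i k - x))) 1 l K)
  (h2 : TendstoUniformlyOn
    (fun i x => ∑ k ∈ s i, w i k x * Real.exp (lam2 * (t i k - x))) 1 l K)

include h0 h1 h2

lemma tendstoUniformlyOn_sum_mul_expPeak :
    TendstoUniformlyOn (fun i x => ∑ k ∈ s i, w i k x * (Real.exp (lam0 * (t i k - x)) *
      expPeak (lam1 - lam0) (lam2 - lam0) (t i k - x))) 0 l K := by
  have hdiv (c : ℝ) : UniformContinuous fun z : ℝ => z / c := by
    simpa only [div_eq_inv_mul] using Real.uniformContinuous_const_mul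
  have h := (hdiv (lam2 - lam1)).comp_tendstoUniformlyOn <|
    ((hdiv (lam2 - lam0)).comp_tendstoUniformlyOn (h2.sub h0)).sub <|
      (hdiv (lam1 - lam0)).comp_tendstoUniformlyOn (h1.sub h0)
  refine (h.congr (.of_forall fun i x _ => ?_)).congr_right fun x _ => by
    simp only [Function.comp_apply, Pi.sub_apply, Pi.zero_apply, sub_self, zero_div]
  simp only [exp_mul_expPeak, Function.comp_apply, Pi.sub_apply, ← Finset.sum_sub_distrib,
    Finset.sum_div]
  exact Finset.sum_congr rfl fun k _ => by ring

theorem tendstoUniformlyOn_sum_smul_of_exp (hK : IsCompact K) (h01 : lam0 ≠ lam1)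
    (h02 : lam0 ≠ lam2) (h12 : lam1 ≠ lam2) (ht : ∀ᶠ i in l, ∀ k ∈ s i, t i k ∈ K)
    (hw : ∀ᶠ i in l, ∀ k ∈ s i, ∀ x ∈ K, 0 ≤ w i k x) {f : ℝ → E} (hf : ContinuousOn f K) :
    TendstoUniformlyOn (fun i x => ∑ k ∈ s i, w i k x • f (t i k)) f l K := by
  rw [Metric.tendstoUniformlyOn_iff]
  intro ε hε
  obtain ⟨C, hC, hmodulus⟩ := exists_norm_exp_smul_sub_le hK h01 h02 h12 hf (ε := ε / 4)
    (by positivity)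
  obtain ⟨B, hB⟩ := hK.exists_bound_of_continuousOn hf
  set d := ε / 2 / (ε / 4 + C + |B|)
  have hd : 0 < d := by positivity
  filter_upwards [ht, hw, Metric.tendstoUniformlyOn_iff.1 h0 d hd,
    Metric.tendstoUniformlyOn_iff.1 (tendstoUniformlyOn_sum_mul_expPeak h0 h1 h2) d hd]
    with i hti hwi hS hP x hx
  specialize hS x hx
  specialize hP x hx
  rw [dist_comm, Pi.one_apply, Real.dist_eq] at hS
  rw [dist_comm, Pi.zero_apply, Real.dist_0_eq_abs] at hP
  rw [dist_comm, dist_eq_norm]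
  have hle := norm_sum_smul_sub_le (fun k hk => hwi k hk x hx)
    (fun k hk => hmodulus x hx (t i k) (hti k hk))
  calc ‖∑ k ∈ s i, w i k x • f (t i k) - f x‖
      ≤ ε / 4 * (1 + d) + C * d + d * |B| := by
        refine hle.trans ?_
        gcongr
        · exact sub_le_iff_le_add'.1 (abs_lt.1 hS).2.le
        · exact (abs_lt.1 hP).2.le
        · exact (hB x hx).trans (le_abs_self B)
    _ = ε / 4 + d * (ε / 4 + C + |B|) := by ring
    _ = ε / 4 + ε / 2 := by rw [div_mul_cancel₀ _ (by positivity)]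
    _ < ε := by linarith

end Net

end Korovkin

/-! ### The weights of the Bernstein operator -/

/-- The Bernstein operator for `(λ₀, λ₁, R)` is the sum of the values `f (t_k)` with these
real-valued weights. -/
noncomputable def bernsteinWeight (a b lam0 lam1 : ℝ) (R : List ℂ) (k : ℕ) (x : ℝ) : ℝ :=
  Real.exp (-lam0 * (bernsteinNode a b lam0 lam1 R k - a)) *
    expCoeff a b lam0 ((lam1 : ℂ) :: R) k *
    (bernsteinBasis ((lam0 : ℂ) :: (lam1 : ℂ) :: R) a b k x).re

section Weights

variable {a b lam0 lam1 : ℝ} {R : List ℂ}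

lemma Admissible.bernsteinOp_eq_sum_bernsteinWeight (hR : Admissible a b R) (lam0 lam1 : ℝ)
    (f : ℝ → ℂ) (x : ℝ) :
    bernsteinOp a b lam0 lam1 R f x = ∑ k ∈ Finset.range (R.length + 2),
      bernsteinWeight a b lam0 lam1 R k x • f (bernsteinNode a b lam0 lam1 R k) := by
  refine Finset.sum_congr rfl fun k hk => ?_
  have hk := Finset.mem_range.1 hk
  have hΛ := (hR.cons lam1).cons lam0
  rw [hR.bernsteinCoeff_eq lam0 lam1 (Nat.le_of_lt_succ hk), ← hΛ.ofReal_re_bernsteinBasis hk,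
    mul_right_comm, ← Complex.ofReal_mul, Complex.real_smul, bernsteinWeight]

lemma Admissible.bernsteinWeight_nonneg (hR : Admissible a b R) {k : ℕ} (hk : k < R.length + 2)
    {x : ℝ} (hx : x ∈ Set.Icc a b) : 0 ≤ bernsteinWeight a b lam0 lam1 R k x :=
  have hΛ := (hR.cons lam1).cons lam0
  mul_nonneg (mul_nonneg (Real.exp_pos _).le (hΛ.expCoeff_pos (Nat.le_of_lt_succ hk)).le)
    (hΛ.bernsteinBasis_re_nonneg hk hx)

lemma Admissible.sum_expCoeff_mul_bernsteinBasis_re {μ : ℝ} {Λ Λ' : List ℂ}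
    (hΛ : Admissible a b ((μ : ℂ) :: Λ)) (hperm : Λ'.Perm ((μ : ℂ) :: Λ)) (x : ℝ) :
    ∑ k ∈ Finset.range Λ'.length, expCoeff a b μ Λ k * (bernsteinBasis Λ' a b k x).re =
      Real.exp (μ * (x - a)) := by
  have h := congrFun hΛ.shiftedExp_eq_sum_bernsteinBasis x
  rw [shiftedExp_ofReal, Finset.sum_apply] at h
  rw [← Complex.ofReal_re (Real.exp _), h, Complex.re_sum, bernsteinBasis_perm hperm,
    hperm.length_eq, List.length_cons]
  simp only [Pi.smul_apply, smul_eq_mul, Complex.re_ofReal_mul]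

lemma abs_exp_sub_one_le_exp_sub_one {y d : ℝ} (hy : |y| ≤ d) :
    |Real.exp y - 1| ≤ Real.exp d - 1 := by
  have hle := Real.exp_le_exp.2 (abs_le.1 hy).2
  have hge := Real.exp_le_exp.2 (abs_le.1 hy).1
  have hcosh := Real.one_le_cosh d
  rw [Real.cosh_eq] at hcosh
  exact abs_le.2 ⟨by linarith, by linarith⟩

lemma abs_sum_mul_exp_sub_one_le {κ : Type*} {s : Finset κ} {q y : κ → ℝ} {d : ℝ}
    (hq : ∀ k ∈ s, 0 ≤ q k) (hq_sum : ∑ k ∈ s, q k = 1) (hy : ∀ k ∈ s, |y k| ≤ d) :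
    |∑ k ∈ s, q k * Real.exp (y k) - 1| ≤ Real.exp d - 1 :=
  calc |∑ k ∈ s, q k * Real.exp (y k) - 1|
      = |∑ k ∈ s, q k * (Real.exp (y k) - 1)| := by
        simp only [mul_sub, mul_one, Finset.sum_sub_distrib, hq_sum]
    _ ≤ ∑ k ∈ s, q k * (Real.exp d - 1) := by
        refine Finset.abs_sum_le_sum_abs _ _ |>.trans (Finset.sum_le_sum fun k hk => ?_)
        rw [abs_mul, abs_of_nonneg (hq k hk)]
        exact mul_le_mul_of_nonneg_left (abs_exp_sub_one_le_exp_sub_one (hy k hk)) (hq k hk)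
    _ = Real.exp d - 1 := by rw [← Finset.sum_mul, hq_sum, one_mul]

lemma Admissible.abs_sum_bernsteinWeight_mul_exp_sub_one_le
    (hR : Admissible a b R) {μ : ℝ} {Λ : List ℂ}
    (hperm : ((lam0 : ℂ) :: (lam1 : ℂ) :: R).Perm ((μ : ℂ) :: Λ)) {y : ℕ → ℝ} {d : ℝ}
    (hy : ∀ k < R.length + 2, expCoeff a b lam0 ((lam1 : ℂ) :: R) k *
      Real.exp ((μ - lam0) * (bernsteinNode a b lam0 lam1 R k - a)) =
        expCoeff a b μ Λ k * Real.exp (y k))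
    (hd : ∀ k < R.length + 2, |y k| ≤ d) {x : ℝ} (hx : x ∈ Set.Icc a b) :
    |∑ k ∈ Finset.range (R.length + 2), bernsteinWeight a b lam0 lam1 R k x *
      Real.exp (μ * (bernsteinNode a b lam0 lam1 R k - x)) - 1| ≤ Real.exp d - 1 := by
  have hΛ₀ := (hR.cons lam1).cons lam0
  have hΛ := hΛ₀.perm hperm
  set t := bernsteinNode a b lam0 lam1 R
  set p : ℕ → ℝ := fun k => (bernsteinBasis ((lam0 : ℂ) :: (lam1 : ℂ) :: R) a b k x).re
  set q : ℕ → ℝ := fun k => expCoeff a b μ Λ k * p k * Real.exp (-μ * (x - a))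
  have hq_nonneg : ∀ k < R.length + 2, 0 ≤ q k := fun k hk =>
    mul_nonneg (mul_nonneg (hΛ.expCoeff_pos (Nat.le_of_lt_succ (hk.trans_eq hperm.length_eq))).le
      (hΛ₀.bernsteinBasis_re_nonneg hk hx)) (Real.exp_pos _).le
  have hq_sum : ∑ k ∈ Finset.range (R.length + 2), q k = 1 := by
    rw [← Finset.sum_mul]
    refine (congrArg (· * _) (hΛ.sum_expCoeff_mul_bernsteinBasis_re hperm x)).trans ?_
    rw [← Real.exp_add, neg_mul, add_neg_cancel, Real.exp_zero]
  have hq : ∀ k < R.length + 2, bernsteinWeight a b lam0 lam1 R k x *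
      Real.exp (μ * (t k - x)) = q k * Real.exp (y k) := by
    intro k hk
    have hexp : Real.exp (μ * (t k - x)) * Real.exp (-lam0 * (t k - a)) =
        Real.exp ((μ - lam0) * (t k - a)) * Real.exp (-μ * (x - a)) := by
      rw [← Real.exp_add, ← Real.exp_add]
      ring_nf
    rw [bernsteinWeight]
    linear_combination expCoeff a b lam0 ((lam1 : ℂ) :: R) k * p k * hexp +
      p k * Real.exp (-μ * (x - a)) * hy k hk
  rw [Finset.sum_congr rfl fun k hk => hq k (Finset.mem_range.1 hk)]
  exact abs_sum_mul_exp_sub_one_le (fun k hk => hq_nonneg k (Finset.mem_range.1 hk)) hq_sum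
    fun k hk => hd k (Finset.mem_range.1 hk)

end Weights

section Limits

variable {ι : Type*} {l : Filter ι} {a b lam0 lam1 : ℝ}

lemma tendstoUniformlyOn_sum_bernsteinWeight_mul_exp {R : ι → List ℂ}
    (hR : ∀ᶠ i in l, Admissible a b (R i)) {μ : ℝ} {Λ : ι → List ℂ}
    (hperm : ∀ i, ((lam0 : ℂ) :: (lam1 : ℂ) :: R i).Perm ((μ : ℂ) :: Λ i)) {y : ι → ℕ → ℝ}
    (hy : ∀ᶠ i in l, ∀ k < (R i).length + 2, expCoeff a b lam0 ((lam1 : ℂ) :: R i) k *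
      Real.exp ((μ - lam0) * (bernsteinNode a b lam0 lam1 (R i) k - a)) =
        expCoeff a b μ (Λ i) k * Real.exp (y i k))
    (hy_small : ∀ d > 0, ∀ᶠ i in l, ∀ k < (R i).length + 2, |y i k| ≤ d) :
    TendstoUniformlyOn (fun i x => ∑ k ∈ Finset.range ((R i).length + 2),
      bernsteinWeight a b lam0 lam1 (R i) k x *
        Real.exp (μ * (bernsteinNode a b lam0 lam1 (R i) k - x))) 1 l (Set.Icc a b) := by
  rw [Metric.tendstoUniformlyOn_iff]
  intro ε hε
  have hlog : 0 < Real.log (1 + ε / 2) := Real.log_pos (by linarith)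
  filter_upwards [hR, hy, hy_small _ hlog] with i hRi hyi hyi_small x hx
  have hle := hRi.abs_sum_bernsteinWeight_mul_exp_sub_one_le (hperm i) hyi hyi_small hx
  rw [Real.exp_log (by positivity)] at hle
  rw [dist_comm, Pi.one_apply, Real.dist_eq]
  linarith

lemma tendstoUniformlyOn_sum_bernsteinWeight_mul_exp_lam0 {R : ι → List ℂ}
    (hR : ∀ᶠ i in l, Admissible a b (R i)) :
    TendstoUniformlyOn (fun i x => ∑ k ∈ Finset.range ((R i).length + 2),
      bernsteinWeight a b lam0 lam1 (R i) k x *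
        Real.exp (lam0 * (bernsteinNode a b lam0 lam1 (R i) k - x))) 1 l (Set.Icc a b) :=
  tendstoUniformlyOn_sum_bernsteinWeight_mul_exp hR (fun _ => List.Perm.refl _) (y := 0)
    (.of_forall fun i k _ => by rw [sub_self, zero_mul, Pi.zero_apply, Pi.zero_apply])
    fun d hd => .of_forall fun i k _ => abs_zero.trans_le hd.le

lemma tendstoUniformlyOn_sum_bernsteinWeight_mul_exp_lam1 {R : ι → List ℂ}
    (hR : ∀ᶠ i in l, Admissible a b (R i)) (h01 : lam0 ≠ lam1) :
    TendstoUniformlyOn (fun i x => ∑ k ∈ Finset.range ((R i).length + 2),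
      bernsteinWeight a b lam0 lam1 (R i) k x *
        Real.exp (lam1 * (bernsteinNode a b lam0 lam1 (R i) k - x))) 1 l (Set.Icc a b) :=
  tendstoUniformlyOn_sum_bernsteinWeight_mul_exp hR (fun _ => List.Perm.swap _ _ _) (y := 0)
    (hR.mono fun i h k hk => by
      rw [h.expCoeff_eq_mul_exp h01 (Nat.le_of_lt_succ hk), mul_assoc, ← Real.exp_add, ← add_mul,
        sub_add_sub_cancel', sub_self, zero_mul, Pi.zero_apply, Pi.zero_apply])
    fun d hd => .of_forall fun i k _ => abs_zero.trans_le hd.le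

variable {lam2 : ℝ}

lemma perm_rotate (x y z : ℂ) (T : List ℂ) : (x :: y :: z :: T).Perm (z :: x :: y :: T) :=
  List.perm_middle (l₁ := [x, y])

namespace Admissible

variable {T : List ℂ} {k : ℕ}

lemma ratioB_eq (hT : Admissible a b T) (lam0 lam1 lam2 : ℝ) (hk : k < T.length + 2) :
    ratioB a b lam0 lam1 lam2 T k = endCoeff a b ((lam0 : ℂ) :: (lam1 : ℂ) :: T) k /
      endCoeff a b ((lam1 : ℂ) :: (lam2 : ℂ) :: T) k := by
  rw [ratioB, ((hT.cons lam1).cons lam0).boundaryLimit_bernsteinBasis ((hT.cons lam2).cons lam1)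
    rfl hk, Complex.ofReal_re]

lemma expCoeff_eq_mul_exp_sum_log_ratioB (hT : Admissible a b T) (lam0 lam1 lam2 : ℝ)
    (hk : k ≤ T.length + 2) :
    expCoeff a b lam0 ((lam1 : ℂ) :: (lam2 : ℂ) :: T) k =
      expCoeff a b lam2 ((lam0 : ℂ) :: (lam1 : ℂ) :: T) k *
        Real.exp (∑ j ∈ Finset.range k, Real.log (ratioB a b lam0 lam1 lam2 T j)) := by
  rw [Real.exp_sum, expCoeff, expCoeff, ← Finset.prod_mul_distrib]
  refine Finset.prod_congr rfl fun j hj => ?_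
  have hj : j < T.length + 2 := (Finset.mem_range.1 hj).trans_le hk
  have hnum := ((hT.cons lam1).cons lam0).endCoeff_pos hj
  have hden := ((hT.cons lam2).cons lam1).endCoeff_pos hj
  rw [hT.ratioB_eq lam0 lam1 lam2 hj, Real.exp_log (div_pos hnum hden),
    endCoeff_perm (perm_rotate lam0 lam1 lam2 T), div_mul_div_cancel₀ hnum.ne']

lemma abs_add_sum_log_ratioB_le (hT : Admissible a b T) (h01 : lam0 ≠ lam1) {ε : ℝ}
    (hlog : ∀ k < T.length + 2, |Real.log (ratioB a b lam0 lam1 lam2 T k) /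
      (bernsteinNode a b lam0 lam1 ((lam2 : ℂ) :: T) k -
        bernsteinNode a b lam0 lam1 ((lam2 : ℂ) :: T) (k + 1)) - (lam2 - lam0)| ≤ ε)
    (hk : k ≤ T.length + 2) :
    |(lam2 - lam0) * (bernsteinNode a b lam0 lam1 ((lam2 : ℂ) :: T) k - a) +
      ∑ j ∈ Finset.range k, Real.log (ratioB a b lam0 lam1 lam2 T j)| ≤
        ε * (bernsteinNode a b lam0 lam1 ((lam2 : ℂ) :: T) k - a) := by
  set t := bernsteinNode a b lam0 lam1 ((lam2 : ℂ) :: T)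
  set L : ℕ → ℝ := fun j => Real.log (ratioB a b lam0 lam1 lam2 T j)
  have hstep : ∀ j ∈ Finset.range k,
      |(lam2 - lam0) * (t (j + 1) - t j) + L j| ≤ ε * (t (j + 1) - t j) := by
    intro j hj
    have hj : j < T.length + 2 := (Finset.mem_range.1 hj).trans_le hk
    have hpos : 0 < t (j + 1) - t j :=
      sub_pos.2 ((hT.cons lam2).bernsteinNode_lt_succ h01 (Nat.le_of_lt_succ hj))
    have hne : t j - t (j + 1) ≠ 0 := (sub_neg.2 (sub_pos.1 hpos)).ne
    have hfactor : (lam2 - lam0) * (t (j + 1) - t j) + L j =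
        -((L j / (t j - t (j + 1)) - (lam2 - lam0)) * (t (j + 1) - t j)) := by
      field_simp
      ring
    rw [hfactor, abs_neg, abs_mul, abs_of_pos hpos]
    exact mul_le_mul_of_nonneg_right (hlog j hj) hpos.le
  have htelescope : t k - a = ∑ j ∈ Finset.range k, (t (j + 1) - t j) :=
    (Finset.sum_range_sub t k).symm
  rw [htelescope, Finset.mul_sum, Finset.mul_sum, ← Finset.sum_add_distrib]
  exact (Finset.abs_sum_le_sum_abs _ _).trans (Finset.sum_le_sum hstep)

end Admissible

lemma tendstoUniformlyOn_sum_bernsteinWeight_mul_exp_lam2 (hab : a < b) {T : ι → List ℂ}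
    (hT : ∀ᶠ i in l, Admissible a b (T i)) (h01 : lam0 ≠ lam1)
    (hlog : ∀ ε > 0, ∀ᶠ i in l, ∀ k < (T i).length + 2,
      |Real.log (ratioB a b lam0 lam1 lam2 (T i) k) /
        (bernsteinNode a b lam0 lam1 ((lam2 : ℂ) :: T i) k -
          bernsteinNode a b lam0 lam1 ((lam2 : ℂ) :: T i) (k + 1)) - (lam2 - lam0)| < ε) :
    TendstoUniformlyOn (fun i x => ∑ k ∈ Finset.range ((T i).length + 3),
      bernsteinWeight a b lam0 lam1 ((lam2 : ℂ) :: T i) k x *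
        Real.exp (lam2 * (bernsteinNode a b lam0 lam1 ((lam2 : ℂ) :: T i) k - x))) 1 l
      (Set.Icc a b) := by
  refine tendstoUniformlyOn_sum_bernsteinWeight_mul_exp (hT.mono fun i h => h.cons lam2)
    (fun i => perm_rotate lam0 lam1 lam2 (T i))
    (y := fun i k => (lam2 - lam0) * (bernsteinNode a b lam0 lam1 ((lam2 : ℂ) :: T i) k - a) +
      ∑ j ∈ Finset.range k, Real.log (ratioB a b lam0 lam1 lam2 (T i) j))
    (hT.mono fun i h k hk => ?_) fun d hd => ?_
  · rw [h.expCoeff_eq_mul_exp_sum_log_ratioB lam0 lam1 lam2 (Nat.le_of_lt_succ hk), mul_assoc,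
      ← Real.exp_add, add_comm]
  · have hε : 0 < d / (b - a) := div_pos hd (sub_pos.2 hab)
    filter_upwards [hT, hlog _ hε] with i h hlog_i k hk
    refine (h.abs_add_sum_log_ratioB_le h01 (fun k hk => (hlog_i k hk).le)
      (Nat.le_of_lt_succ hk)).trans ?_
    have hnode := ((h.cons lam2).bernsteinNode_mem_Icc h01 (Nat.le_of_lt_succ hk)).2
    calc d / (b - a) * (bernsteinNode a b lam0 lam1 ((lam2 : ℂ) :: T i) k - a)
        ≤ d / (b - a) * (b - a) :=
          mul_le_mul_of_nonneg_left (sub_le_sub_right hnode a) hε.le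
      _ = d := div_mul_cancel₀ d (sub_pos.2 hab).ne'

end Limits

theorem theorem4p2_general {ι : Type*} {l : Filter ι} {a b : ℝ} (hab : a < b)
    {lam0 lam1 lam2 : ℝ} (h01 : lam0 ≠ lam1) (h02 : lam0 ≠ lam2) (h12 : lam1 ≠ lam2)
    {T : ι → List ℂ}
    (hconj : ∀ᶠ i in l,
      ClosedUnderConj (expPolySpace ((lam0 : ℂ) :: (lam1 : ℂ) :: (lam2 : ℂ) :: T i)))
    (him : ∀ᶠ i in l, ∀ μ ∈ (lam0 : ℂ) :: (lam1 : ℂ) :: (lam2 : ℂ) :: T i,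
      |μ.im| * (b - a) < Real.pi)
    (hlog : ∀ ε > 0, ∀ᶠ i in l, ∀ k < (T i).length + 2,
      |Real.log (ratioB a b lam0 lam1 lam2 (T i) k) /
        (bernsteinNode a b lam0 lam1 ((lam2 : ℂ) :: T i) k -
          bernsteinNode a b lam0 lam1 ((lam2 : ℂ) :: T i) (k + 1)) - (lam2 - lam0)| < ε)
    {f : ℝ → ℂ} (hf : ContinuousOn f (Set.Icc a b)) :
    TendstoUniformlyOn (fun i x => bernsteinOp a b lam0 lam1 ((lam2 : ℂ) :: T i) f x) f l
      (Set.Icc a b) := by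
  have hT : ∀ᶠ i in l, Admissible a b (T i) := hconj.mp <| him.mono fun i hi hi' =>
    (⟨hab, perm_map_star_of_closedUnderConj hi', hi⟩ : Admissible a b _).of_cons.of_cons.of_cons
  have hR : ∀ᶠ i in l, Admissible a b ((lam2 : ℂ) :: T i) := hT.mono fun i h => h.cons lam2
  refine (tendstoUniformlyOn_sum_smul_of_exp
    (tendstoUniformlyOn_sum_bernsteinWeight_mul_exp_lam0 hR)
    (tendstoUniformlyOn_sum_bernsteinWeight_mul_exp_lam1 hR h01)
    (tendstoUniformlyOn_sum_bernsteinWeight_mul_exp_lam2 hab hT h01 hlog)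
    isCompact_Icc h01 h02 h12 ?_ ?_ hf).congr ?_
  · exact hR.mono fun i h k hk =>
      h.bernsteinNode_mem_Icc h01 (Nat.le_of_lt_succ (Finset.mem_range.1 hk))
  · exact hR.mono fun i h k hk x hx => h.bernsteinWeight_nonneg (Finset.mem_range.1 hk) hx
  · exact hR.mono fun i h x _ => (h.bernsteinOp_eq_sum_bernsteinWeight lam0 lam1 f x).symm

/-- `T n` is the list `(λ₃, …, λₙ)` of the eigenvalues that may vary with `n`. -/
theorem theorem4p2 (a b : ℝ) (hab : a < b) (lam0 lam1 lam2 : ℝ)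
    (h01 : lam0 ≠ lam1) (h02 : lam0 ≠ lam2) (h12 : lam1 ≠ lam2)
    (T : ℕ → List ℂ) (hT : ∀ n, 2 ≤ n → (T n).length + 2 = n)
    (hconj : ∀ n, 2 ≤ n →
      ClosedUnderConj (expPolySpace ((lam0 : ℂ) :: (lam1 : ℂ) :: (lam2 : ℂ) :: T n)))
    (M : ℝ) (hM : 0 < M)
    (hIm : ∀ n, 2 ≤ n → ∀ μ ∈ (lam0 : ℂ) :: (lam1 : ℂ) :: (lam2 : ℂ) :: T n, |μ.im| ≤ M)
    (hlength : ∀ n, 2 ≤ n → ∀ μ ∈ (lam0 : ℂ) :: (lam1 : ℂ) :: (lam2 : ℂ) :: T n,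
      |μ.im| * (b - a) < Real.pi)
    (hmesh : ∀ ε > 0, ∃ n₀ : ℕ, ∀ n ≥ n₀, ∀ k < n,
      |bernsteinNode a b lam0 lam1 ((lam2 : ℂ) :: T n) (k + 1) -
        bernsteinNode a b lam0 lam1 ((lam2 : ℂ) :: T n) k| < ε)
    (hlog : ∀ ε > 0, ∃ n₀ : ℕ, ∀ n ≥ n₀, ∀ k < n,
      |Real.log (ratioB a b lam0 lam1 lam2 (T n) k) /
          (bernsteinNode a b lam0 lam1 ((lam2 : ℂ) :: T n) k -
            bernsteinNode a b lam0 lam1 ((lam2 : ℂ) :: T n) (k + 1)) -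
        (lam2 - lam0)| < ε)
    (f : ℝ → ℂ) (hf : ContinuousOn f (Set.Icc a b)) :
    TendstoUniformlyOn (fun n x => bernsteinOp a b lam0 lam1 ((lam2 : ℂ) :: T n) f x)
      f atTop (Set.Icc a b) := by
  refine theorem4p2_general hab h01 h02 h12 ?_ ?_ (fun ε hε => ?_) hf
  · exact (eventually_ge_atTop 2).mono hconj
  · exact (eventually_ge_atTop 2).mono hlength
  · filter_upwards [eventually_atTop.2 (hlog ε hε), eventually_ge_atTop 2] with n hn hn2 k hk
    exact hn k (hk.trans_eq (hT n hn2))
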